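/- Setting. A hypothesis $H\in\{0,1\}$ is random with an arbitrary prior $P(H=0)=p_0$. Finitely many sensors $1,\dots,N$ take observations $Y^i_t$, $t=1,\dots,T$ ($T\ge 1$). Given $H$, the observations of one sensor at different times are independent, and the observation sequences of different sensors are independent. A directed graph on the sensors is given, and $\mathcal P^i$ denotes the set of sensors $j$ with an edge from $j$ to $i$. At time $t$ a sensor $i$ that has not stopped before chooses $U^i_t=\gamma^i_t(Y^i_{1:t},U^{\mathcal P^i}_{1:t-1})\in\{0,1,b\}$ by a measurable decision rule. The values $0$ and $1$ are final decisions, $b$ means that it continues, and at time $T$ the value $b$ is not allowed. After a sensor has stopped, all its further decisions are $b$. A strategy of sensor $i$ is a family $\Gamma^i=(\gamma^i_t)_{t}$ of such rules. Let $\tau^i=\min\{t:U^i_t\ne b\}$. For arbitrary real functions $O$ and $A$ the total cost is $J=O(\tau^1,\dots,\tau^N)+A(H,U^1_{\tau^1},\dots,U^N_{\tau^N},\tau^1,\dots,\tau^N)$. The belief of sensor $i$ at time $t$, if it has not stopped before $t$, is $\Pi^i_t=P(H=0\mid Y^i_{1:t},U^{\mathcal P^i}_{1:t-1},U^i_{1:t-1}=b_{1:t-1})$.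 Theorem. Fix a sensor $i$ and arbitrary strategies of all sensors $j\ne i$. Then there is a strategy of sensor $i$ that minimizes $\mathbb E[J]$ over all strategies of sensor $i$ and has the following form. For each time $t\in\{1,\dots,T\}$ and each realization $u=u^{\mathcal P^i}_{1:t-1}$ of the messages received by sensor $i$ there are (possibly empty) closed intervals $[\alpha_t(u),\beta_t(u)]$ and $[\delta_t(u),\theta_t(u)]$ with endpoints in $[0,1]$, having at most one point in common, such that, if sensor $i$ has not stopped before $t$, then almost surely, with $u=U^{\mathcal P^i}_{1:t-1}$, $$U^i_t=\begin{cases}1 & \text{if } \Pi^i_t\in[\alpha_t(u),\beta_t(u)],\\ 0 & \text{if } \Pi^i_t\in[\delta_t(u),\theta_t(u)] \text{ and } \Pi^i_t\notin[\alpha_t(u),\beta_t(u)],\\ b & \text{otherwise.}\end{cases}$$ Moreover, for $t=T$ and every $u$, $[\alpha_T(u),\beta_T(u)]\cup[\delta_T(u),\theta_T(u)]=[0,1]$. -/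

import Mathlib

open MeasureTheory ProbabilityTheory

/-- What a sensor emits at one time instant: a final decision `0`, a final decision `1`,
or the blank `b` (it continues, or it has become inactive). -/
inductive Msg : Type
  | zero
  | one
  | blank

instance : MeasurableSpace Msg := ⊤

/-- The data of the sequential detection problem, apart from the random variables: the directed
communication graph (an edge `j ⟶ i` means that the final decision of `j` is sent to `i`), the
horizon `T ≥ 1`, the operational cost `O(τ¹, …, τᴺ)` and the terminal cost
`A(H, U¹, …, Uᴺ, τ¹, …, τᴺ)`, which are arbitrary real functions. -/
structure SensorNetwork (ι : Type*) where
  graph : Digraph ι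
  T : ℕ
  one_le_T : 1 ≤ T
  O : (ι → ℕ) → ℝ
  A : Fin 2 → (ι → Msg) → (ι → ℕ) → ℝ

namespace SensorNetwork

/-- The set `Pⁱ` of the sensors whose decisions sensor `i` receives. -/
abbrev Parents {ι : Type*} (N : SensorNetwork ι) (i : ι) : Type _ := {j : ι // N.graph.Adj j i}

/-- Realizations `u_{1:t-1}` of the messages received by sensor `i` before its decision at `t`. -/
abbrev MsgHist {ι : Type*} (N : SensorNetwork ι) (i : ι) (t : ℕ) : Type _ :=
  Finset.Ico 1 t → N.Parents i → Msg

/-- A decision strategy of sensor `i`: for each time `t = 1, 2, …` a (measurable) decision rule,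
which maps the own observations `y_{1:t}` and the received messages `u_{1:t-1}` to a decision.
At the horizon `T` the sensor is not allowed to continue. (The rule with index `0` and those with
index larger than `T` have no effect.) -/
structure Strategy {ι : Type*} (N : SensorNetwork ι) (𝒴 : ι → Type*)
    [∀ i, MeasurableSpace (𝒴 i)] (i : ι) where
  rule : ∀ t : ℕ, (Finset.Icc 1 t → 𝒴 i) → N.MsgHist i t → Msg
  measurable_rule : ∀ t : ℕ,
    Measurable fun z : (Finset.Icc 1 t → 𝒴 i) × N.MsgHist i t => rule t z.1 z.2
  stops : ∀ y u, rule N.T y u ≠ Msg.blank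

section Dynamics

variable {ι : Type*} (N : SensorNetwork ι) {𝒴 : ι → Type*} [∀ i, MeasurableSpace (𝒴 i)]

open scoped Classical in
/-- The decision `Uⁱ_t` under the strategy profile `Γ` when the observation sequences of the
sensors are `y`. It is `b` if the sensor has stopped before `t`; otherwise it is given by the
decision rule `γⁱ_t` applied to `y_{1:t}` and the received messages. -/
noncomputable def decision (Γ : ∀ i, N.Strategy 𝒴 i) (y : ∀ i, ℕ → 𝒴 i) (t : ℕ) (i : ι) : Msg :=
  if ∃ s : Finset.Ico 1 t, decision Γ y s.1 i ≠ Msg.blank then Msg.blank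
  else (Γ i).rule t (fun s => y i s.1) (fun s j => decision Γ y s.1 j.1)
termination_by t
decreasing_by all_goals exact (Finset.mem_Ico.mp (Subtype.prop _)).2

/-- The stopping time `τⁱ = min {t ≥ 1 : Uⁱ_t ≠ b}`. -/
noncomputable def stopTime (Γ : ∀ i, N.Strategy 𝒴 i) (y : ∀ i, ℕ → 𝒴 i) (i : ι) : ℕ :=
  sInf {t : ℕ | 1 ≤ t ∧ N.decision Γ y t i ≠ Msg.blank}

/-- The total cost `J(H, {Uⁱ_{τⁱ}, τⁱ}) = O(τ) + A(H, U_τ, τ)`. -/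
noncomputable def cost (Γ : ∀ i, N.Strategy 𝒴 i) (h : Fin 2) (y : ∀ i, ℕ → 𝒴 i) : ℝ :=
  N.O (N.stopTime Γ y)
    + N.A h (fun i => N.decision Γ y (N.stopTime Γ y i) i) (N.stopTime Γ y)

variable {Ω : Type*} [MeasurableSpace Ω]

/-- The probabilistic assumptions on the hypothesis `H` and on the observations `Yⁱ_t`.
The prior probability `p₀ = P(H = 0)` is arbitrary in `[0, 1]`. The conditional laws of the
observations given `H` are arbitrary: the two laws of `Yⁱ_t` (given `H = 0` and given `H = 1`)
always have densities with respect to their sum, and discrete laws and laws with a density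
with respect to Lebesgue measure are the typical cases. -/
structure ObservationModel (P : Measure Ω) (H : Ω → Fin 2) (Y : ∀ i, ℕ → Ω → 𝒴 i) : Prop where
  measurable_H : Measurable H
  measurable_Y : ∀ i t, Measurable (Y i t)
  /-- given `H`, the observations of one sensor at different times are independent -/
  indep_time : ∀ h : Fin 2, P (H ⁻¹' {h}) ≠ 0 → ∀ i,
    iIndepFun (fun (t : Finset.Icc 1 N.T) ω => Y i t.1 ω) P[|H ⁻¹' {h}]
  /-- given `H`, the observation sequences of different sensors are independent -/
  indep_sensor : ∀ h : Fin 2, P (H ⁻¹' {h}) ≠ 0 →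
    iIndepFun (fun (i : ι) ω (t : Finset.Icc 1 N.T) => Y i t.1 ω) P[|H ⁻¹' {h}]

/-- The random variable `Uⁱ_t`. -/
noncomputable def U (Y : ∀ i, ℕ → Ω → 𝒴 i) (Γ : ∀ i, N.Strategy 𝒴 i) (i : ι) (t : ℕ)
    (ω : Ω) : Msg :=
  N.decision Γ (fun j s => Y j s ω) t i

/-- The messages `U^{Pⁱ}_{1:t-1}` received by sensor `i` before its decision at time `t`. -/
noncomputable def received (Y : ∀ i, ℕ → Ω → 𝒴 i) (Γ : ∀ i, N.Strategy 𝒴 i) (i : ι) (t : ℕ)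
    (ω : Ω) : N.MsgHist i t :=
  fun s j => N.U Y Γ j.1 s.1 ω

/-- The event `Uⁱ_{1:t-1} = b_{1:t-1}`: sensor `i` has not stopped before time `t`. -/
def Active (Y : ∀ i, ℕ → Ω → 𝒴 i) (Γ : ∀ i, N.Strategy 𝒴 i) (i : ι) (t : ℕ) (ω : Ω) : Prop :=
  ∀ s : Finset.Ico 1 t, N.U Y Γ i s.1 ω = Msg.blank

/-- The `σ`-algebra generated by `Yⁱ_{1:t}`, `U^{Pⁱ}_{1:t-1}` and `Uⁱ_{1:t-1}`. -/
@[reducible] noncomputable def info (Y : ∀ i, ℕ → Ω → 𝒴 i) (Γ : ∀ i, N.Strategy 𝒴 i) (i : ι) (t : ℕ) : MeasurableSpace Ω :=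
  MeasurableSpace.comap
    (fun ω => ((fun s : Finset.Icc 1 t => Y i s.1 ω), N.received Y Γ i t ω,
      (fun s : Finset.Ico 1 t => N.U Y Γ i s.1 ω)))
    inferInstance

/-- The belief `Πⁱ_t`: the conditional probability of `H = 0` given `Yⁱ_{1:t}`,
`U^{Pⁱ}_{1:t-1}` and `Uⁱ_{1:t-1}`. It is only used on the event `Uⁱ_{1:t-1} = b_{1:t-1}`. -/
noncomputable def belief (P : Measure Ω) (H : Ω → Fin 2) (Y : ∀ i, ℕ → Ω → 𝒴 i)
    (Γ : ∀ i, N.Strategy 𝒴 i) (i : ι) (t : ℕ) : Ω → ℝ :=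
  P[(H ⁻¹' {0}).indicator (fun _ => (1 : ℝ)) | N.info Y Γ i t]

/-- The system objective: the expected cost of the strategy profile `Γ`. -/
noncomputable def expectedCost (P : Measure Ω) (H : Ω → Fin 2) (Y : ∀ i, ℕ → Ω → 𝒴 i)
    (Γ : ∀ i, N.Strategy 𝒴 i) : ℝ :=
  ∫ ω, N.cost Γ (H ω) (fun j s => Y j s ω) ∂P

/-- With the strategies `Γ j` of the sensors `j ≠ i` fixed, `γ` is an optimal strategy of
sensor `i`. (The component `Γ i` plays no role.) -/
def IsOptimalFor [DecidableEq ι] (P : Measure Ω) (H : Ω → Fin 2) (Y : ∀ i, ℕ → Ω → 𝒴 i)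
    (Γ : ∀ i, N.Strategy 𝒴 i) (i : ι) (γ : N.Strategy 𝒴 i) : Prop :=
  ∀ γ' : N.Strategy 𝒴 i, N.expectedCost P H Y (Function.update Γ i γ)
    ≤ N.expectedCost P H Y (Function.update Γ i γ')

end Dynamics

end SensorNetwork

open scoped Classical in
/-- The 4-threshold rule: decide `1` on `[α, β]`, decide `0` on `[δ, θ]`, continue otherwise
(cases in this order; `[a, b]` is empty if `a > b`). -/
noncomputable def fourThreshold (α β δ θ π : ℝ) : Msg :=
  if π ∈ Set.Icc α β then Msg.one
  else if π ∈ Set.Icc δ θ then Msg.zero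
  else Msg.blank

/-! Sensor `i` sends only blanks before it stops. Hence, as long as it has not stopped, the messages
it receives are those it would receive if it never stopped (`silentMsgs`), and the cost is a
function of the time and the value of its decision and of the observations of the other sensors
(`cost_eq_playCost`). Given `H`, these are independent of the observations of sensor `i`. So
sensor `i` faces an optimal stopping problem with two terminal decisions (`DetectionProblem`), and
everything it knows about the rest of the network is a message with a conditional law given `H` and
the message history.

This problem is solved by backward induction. The state is the unnormalized belief, the vector of
the joint weights of the hypotheses `h`, the message history and the observations so far, the
latter measured by densities with respect to a reference law under which the observations of
sensor `i` are independent. A Bayes update multiplies this vector componentwise by the transition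
probability of the messages and the likelihood of the next observation. The costs of the two
decisions are linear in the state. The cost of continuing is an integral of minima of such
functions, hence Lipschitz, concave and positively homogeneous (`IsCostToGo`), so that all
minimizations can be restricted to normalized beliefs. There, the set where a given decision is the
best action is closed and convex, as the set where an affine function lies below another affine
function and a continuous concave one. That is an interval. The two intervals meet at most at the
crossing point of the two affine costs, unless these are equal, in which case the second interval
is taken to be empty (`exists_fourThreshold_optimal`).

The expected cost of any strategy is the optimal value plus its nonnegative losses at the single
times (`DetectionProblem.sum_stageCost`), and the threshold rules have no loss. Finally, the belief
of sensor `i` agrees with the normalized state while it is active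
(`SensorNetwork.ObservationModel.belief_ae_eq`): Bayes' rule gives the conditional probability given
the observations and the messages under silence, and on the event that the sensor is active the
latter generate the same events as the information of the sensor. -/

/-! ### Costs as functions of the unnormalized belief -/

/-- A cost-to-go as a function of the unnormalized belief `b`, where `b h` is the weight of the
hypothesis `h`. All costs-to-go of the dynamic program have these properties. They are required on
the whole plane, not only where the weights are nonnegative. -/
structure IsCostToGo (G : (Fin 2 → ℝ) → ℝ) : Prop where
  lipschitz : ∃ K, 0 ≤ K ∧ ∀ b b', |G b - G b'| ≤ K * ‖b - b'‖
  concave : ConcaveOn ℝ Set.univ G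
  homogeneous : ∀ s : ℝ, 0 ≤ s → ∀ b, G (s • b) = s * G b

namespace IsCostToGo

variable {G G' : (Fin 2 → ℝ) → ℝ}

theorem map_zero (hG : IsCostToGo G) : G 0 = 0 := by
  have := hG.homogeneous 0 le_rfl 0
  simpa using this

theorem continuous (hG : IsCostToGo G) : Continuous G := by
  obtain ⟨K, -, hK⟩ := hG.lipschitz
  refine (LipschitzWith.of_dist_le' (K := K) fun b b' => ?_).continuous
  rw [Real.dist_eq, dist_eq_norm]
  exact hK b b'

theorem exists_abs_le (hG : IsCostToGo G) : ∃ K, 0 ≤ K ∧ ∀ b, |G b| ≤ K * ‖b‖ := by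
  obtain ⟨K, hK0, hK⟩ := hG.lipschitz
  exact ⟨K, hK0, fun b => by simpa [hG.map_zero] using hK b 0⟩

theorem linear (c : Fin 2 → ℝ) : IsCostToGo fun b => ∑ h, c h * b h where
  lipschitz := by
    refine ⟨∑ h, |c h|, Finset.sum_nonneg fun _ _ => abs_nonneg _, fun b b' => ?_⟩
    rw [← Finset.sum_sub_distrib, Finset.sum_mul]
    refine (Finset.abs_sum_le_sum_abs _ _).trans (Finset.sum_le_sum fun h _ => ?_)
    rw [← mul_sub, abs_mul]
    exact mul_le_mul_of_nonneg_left (norm_le_pi_norm (b - b') h) (abs_nonneg _)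
  concave := by
    refine ⟨convex_univ, fun b _ b' _ s s' _ _ _ => le_of_eq ?_⟩
    simp only [smul_eq_mul, Pi.add_apply, Pi.smul_apply, Fin.sum_univ_two]
    ring
  homogeneous s _ b := by
    simp only [Pi.smul_apply, smul_eq_mul, Fin.sum_univ_two]
    ring

theorem min (hG : IsCostToGo G) (hG' : IsCostToGo G') : IsCostToGo fun b => min (G b) (G' b) where
  lipschitz := by
    obtain ⟨K, hK0, hK⟩ := hG.lipschitz
    obtain ⟨K', hK0', hK'⟩ := hG'.lipschitz
    refine ⟨max K K', le_max_of_le_left hK0, fun b b' => ?_⟩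
    refine (abs_min_sub_min_le_max _ _ _ _).trans (max_le ((hK b b').trans ?_) ((hK' b b').trans ?_))
    · gcongr; exact le_max_left _ _
    · gcongr; exact le_max_right _ _
  concave := hG.concave.inf hG'.concave
  homogeneous s hs b := by
    rw [hG.homogeneous s hs, hG'.homogeneous s hs, mul_min_of_nonneg _ _ hs]

theorem finset_sum {α : Type*} (S : Finset α) {F : α → (Fin 2 → ℝ) → ℝ}
    (hF : ∀ x, IsCostToGo (F x)) : IsCostToGo fun b => ∑ x ∈ S, F x b where
  lipschitz := by
    choose K hK0 hK using fun x => (hF x).lipschitz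
    refine ⟨∑ x ∈ S, K x, Finset.sum_nonneg fun x _ => hK0 x, fun b b' => ?_⟩
    rw [← Finset.sum_sub_distrib, Finset.sum_mul]
    exact (Finset.abs_sum_le_sum_abs _ _).trans (Finset.sum_le_sum fun x _ => hK x b b')
  concave := by
    refine ⟨convex_univ, fun b _ b' _ s s' hs hs' hss => ?_⟩
    simp only [smul_eq_mul, Finset.mul_sum]
    rw [← Finset.sum_add_distrib]
    exact Finset.sum_le_sum fun x _ => by
      simpa using (hF x).concave.2 (Set.mem_univ b) (Set.mem_univ b') hs hs' hss
  homogeneous s hs b := by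
    rw [Finset.mul_sum]
    exact Finset.sum_congr rfl fun x _ => (hF x).homogeneous s hs b

variable {α : Type*} [MeasurableSpace α] {μ : Measure α} {g : α → Fin 2 → ℝ}

theorem integrable_comp (hG : IsCostToGo G) (hg : Integrable g μ) :
    Integrable (fun x => G (g x)) μ := by
  obtain ⟨K, hK0, hK⟩ := hG.exists_abs_le
  refine (hg.norm.const_mul K).mono' (hG.continuous.comp_aestronglyMeasurable hg.1) ?_
  exact Filter.Eventually.of_forall fun x => hK _

theorem integrable_mul_left (hg : Integrable g μ) (b : Fin 2 → ℝ) :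
    Integrable (fun x => b * g x) μ :=
  Integrable.of_eval fun h => (hg.eval h).const_mul (b h)

/-- The expected cost-to-go after a Bayes update with likelihoods `g x`, `x ∼ μ`. -/
theorem integral_mul (hG : IsCostToGo G) (hg : Integrable g μ) :
    IsCostToGo fun b => ∫ x, G (b * g x) ∂μ where
  lipschitz := by
    obtain ⟨K, hK0, hK⟩ := hG.lipschitz
    refine ⟨K * ∫ x, ‖g x‖ ∂μ, mul_nonneg hK0 (integral_nonneg fun x => norm_nonneg _),
      fun b b' => ?_⟩
    rw [← integral_sub (hG.integrable_comp (integrable_mul_left hg b))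
      (hG.integrable_comp (integrable_mul_left hg b')), ← Real.norm_eq_abs]
    refine (norm_integral_le_integral_norm _).trans ?_
    rw [mul_right_comm, ← integral_const_mul]
    refine integral_mono_of_nonneg (Filter.Eventually.of_forall fun x => norm_nonneg _)
      (hg.norm.const_mul _) (Filter.Eventually.of_forall fun x => ?_)
    refine (hK _ _).trans ?_
    rw [← sub_mul]
    exact (mul_le_mul_of_nonneg_left (norm_mul_le _ _) hK0).trans_eq (mul_assoc _ _ _).symm
  concave := by
    refine ⟨convex_univ, fun b _ b' _ s s' hs hs' hss => ?_⟩
    simp only [smul_eq_mul]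
    rw [← integral_const_mul, ← integral_const_mul, ← integral_add
      ((hG.integrable_comp (integrable_mul_left hg b)).const_mul s)
      ((hG.integrable_comp (integrable_mul_left hg b')).const_mul s')]
    refine integral_mono
      (((hG.integrable_comp (integrable_mul_left hg b)).const_mul s).add
      ((hG.integrable_comp (integrable_mul_left hg b')).const_mul s'))
      (hG.integrable_comp (integrable_mul_left hg _)) fun x => ?_
    have := hG.concave.2 (Set.mem_univ (b * g x)) (Set.mem_univ (b' * g x)) hs hs' hss
    simpa only [add_mul, smul_mul_assoc, smul_eq_mul] using this
  homogeneous s hs b := by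
    rw [← integral_const_mul]
    exact integral_congr_ae (Filter.Eventually.of_forall fun x => by
      simp only [smul_mul_assoc, hG.homogeneous s hs])

end IsCostToGo

/-! ### The threshold structure of an optimal decision -/

/-- A closed convex subset of `[0, 1]` is an interval with endpoints in `[0, 1]`; the empty set is
`[1, 0]`. -/
theorem exists_Icc_eq_of_isClosed_of_convex {S : Set ℝ} (hS : S ⊆ Set.Icc 0 1) (hc : IsClosed S)
    (hconv : Convex ℝ S) :
    ∃ α ∈ Set.Icc (0 : ℝ) 1, ∃ β ∈ Set.Icc (0 : ℝ) 1, Set.Icc α β = S := by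
  rcases S.eq_empty_or_nonempty with rfl | hne
  · exact ⟨1, by simp, 0, by simp, by simp⟩
  · have hcomp : IsCompact S := isCompact_Icc.of_isClosed_subset hc hS
    refine ⟨sInf S, hS (hcomp.sInf_mem hne), sSup S, hS (hcomp.sSup_mem hne), ?_⟩
    exact (eq_Icc_of_connected_compact ⟨hne, hconv.isPreconnected⟩ hcomp).symm

/-- The normalized belief with probability `π` of the hypothesis `0`. -/
def beliefVec (π : ℝ) : Fin 2 → ℝ := ![π, 1 - π]

theorem continuous_beliefVec : Continuous beliefVec := by
  refine continuous_pi fun h => ?_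
  fin_cases h
  · exact continuous_id
  · exact continuous_const.sub continuous_id

theorem beliefVec_combo (x y s s' : ℝ) (hss : s + s' = 1) :
    beliefVec (s • x + s' • y) = s • beliefVec x + s' • beliefVec y := by
  funext h
  fin_cases h
  · simp [beliefVec]
  · simp only [beliefVec, smul_eq_mul, Fin.mk_one, Matrix.cons_val_one, Matrix.cons_val_fin_one, Pi.add_apply, Pi.smul_apply]
    linear_combination (-1 : ℝ) * hss

/-- The set of beliefs at which stopping with the linear cost `c` is at least as good as both
stopping with the linear cost `c'` and a further option with cost `C`. -/
def stopRegion (c c' : Fin 2 → ℝ) (C : (Fin 2 → ℝ) → ℝ) : Set ℝ :=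
  {π ∈ Set.Icc (0 : ℝ) 1 | ∑ h, c h * beliefVec π h ≤ ∑ h, c' h * beliefVec π h ∧
    ∑ h, c h * beliefVec π h ≤ C (beliefVec π)}

theorem mem_stopRegion {c c' : Fin 2 → ℝ} {C : (Fin 2 → ℝ) → ℝ} {π : ℝ} :
    π ∈ stopRegion c c' C ↔ π ∈ Set.Icc (0 : ℝ) 1 ∧
      ∑ h, c h * beliefVec π h ≤ ∑ h, c' h * beliefVec π h ∧
      ∑ h, c h * beliefVec π h ≤ C (beliefVec π) :=
  Iff.rfl

theorem exists_Icc_eq_stopRegion (c c' : Fin 2 → ℝ) {C : (Fin 2 → ℝ) → ℝ} (hC : IsCostToGo C) :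
    ∃ α ∈ Set.Icc (0 : ℝ) 1, ∃ β ∈ Set.Icc (0 : ℝ) 1, Set.Icc α β = stopRegion c c' C := by
  refine exists_Icc_eq_of_isClosed_of_convex (fun π hπ => hπ.1) ?_ ?_
  · have h1 : ∀ c : Fin 2 → ℝ, Continuous fun π => ∑ h, c h * beliefVec π h := fun c =>
      (IsCostToGo.linear c).continuous.comp continuous_beliefVec
    exact isClosed_Icc.inter ((isClosed_le (h1 c) (h1 c')).inter
      (isClosed_le (h1 c) (hC.continuous.comp continuous_beliefVec)))
  · intro x hx y hy s s' hs hs' hss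
    have hlin : ∀ c : Fin 2 → ℝ, ∑ h, c h * beliefVec (s • x + s' • y) h
        = s * (∑ h, c h * beliefVec x h) + s' * ∑ h, c h * beliefVec y h := by
      intro c
      rw [beliefVec_combo x y s s' hss]
      simp only [Pi.add_apply, Pi.smul_apply, smul_eq_mul, Fin.sum_univ_two]
      ring
    refine ⟨convex_Icc 0 1 hx.1 hy.1 hs hs' hss, ?_, ?_⟩
    · rw [hlin, hlin]
      exact add_le_add (mul_le_mul_of_nonneg_left hx.2.1 hs) (mul_le_mul_of_nonneg_left hy.2.1 hs')
    · rw [hlin, beliefVec_combo x y s s' hss]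
      exact (add_le_add (mul_le_mul_of_nonneg_left hx.2.2 hs)
        (mul_le_mul_of_nonneg_left hy.2.2 hs')).trans
        (hC.concave.2 (Set.mem_univ _) (Set.mem_univ _) hs hs' hss)

/-- The cost of the action `m`: `c₁` and `c₀` are the linear costs of the decisions `1` and `0`,
and `C` is the cost of continuing. -/
def actionCost (c₁ c₀ : Fin 2 → ℝ) (C : (Fin 2 → ℝ) → ℝ) : Msg → (Fin 2 → ℝ) → ℝ
  | Msg.one => fun b => ∑ h, c₁ h * b h
  | Msg.zero => fun b => ∑ h, c₀ h * b h
  | Msg.blank => C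

theorem isCostToGo_actionCost (c₁ c₀ : Fin 2 → ℝ) {C : (Fin 2 → ℝ) → ℝ} (hC : IsCostToGo C) :
    ∀ m, IsCostToGo (actionCost c₁ c₀ C m)
  | Msg.one => .linear c₁
  | Msg.zero => .linear c₀
  | Msg.blank => hC

/-- The minimum of the costs of the three actions. -/
noncomputable def minCost (c₁ c₀ : Fin 2 → ℝ) (C : (Fin 2 → ℝ) → ℝ) (b : Fin 2 → ℝ) : ℝ :=
  min (min (∑ h, c₁ h * b h) (∑ h, c₀ h * b h)) (C b)

theorem isCostToGo_minCost (c₁ c₀ : Fin 2 → ℝ) {C : (Fin 2 → ℝ) → ℝ} (hC : IsCostToGo C) :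
    IsCostToGo (minCost c₁ c₀ C) :=
  ((IsCostToGo.linear c₁).min (.linear c₀)).min hC

theorem minCost_le_actionCost (c₁ c₀ : Fin 2 → ℝ) (C : (Fin 2 → ℝ) → ℝ) (b : Fin 2 → ℝ) :
    ∀ m, minCost c₁ c₀ C b ≤ actionCost c₁ c₀ C m b
  | Msg.one => (min_le_left _ _).trans (min_le_left _ _)
  | Msg.zero => (min_le_left _ _).trans (min_le_right _ _)
  | Msg.blank => min_le_right _ _

/-- Two affine functions that agree at two points are equal. -/
theorem linear_beliefVec_eq_of_two {c c' : Fin 2 → ℝ} {x y : ℝ} (hxy : x ≠ y)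
    (hx : ∑ h, c h * beliefVec x h = ∑ h, c' h * beliefVec x h)
    (hy : ∑ h, c h * beliefVec y h = ∑ h, c' h * beliefVec y h) : c = c' := by
  simp only [beliefVec, Fin.sum_univ_two, Matrix.cons_val_zero, Matrix.cons_val_one,
    Matrix.cons_val_fin_one] at hx hy
  have hd : (x - y) * (c 0 - c' 0 - (c 1 - c' 1)) = 0 := by linear_combination hx - hy
  have hd' : c 0 - c' 0 - (c 1 - c' 1) = 0 :=
    (mul_eq_zero.mp hd).resolve_left (sub_ne_zero.mpr hxy)
  have h1 : c 1 = c' 1 := by linear_combination hx - x * hd'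
  funext h
  fin_cases h
  · change c 0 = c' 0
    linear_combination hd' + h1
  · exact h1

/-- An optimal action is a four-threshold rule of the normalized belief. If the two decisions have
the same cost, the second interval has to be empty, and otherwise the two stopping regions meet
only where the two affine costs cross. -/
theorem exists_fourThreshold_optimal (c₁ c₀ : Fin 2 → ℝ) {C : (Fin 2 → ℝ) → ℝ}
    (hC : IsCostToGo C) :
    ∃ α β δ θ : ℝ, (α ∈ Set.Icc (0 : ℝ) 1 ∧ β ∈ Set.Icc (0 : ℝ) 1 ∧ δ ∈ Set.Icc (0 : ℝ) 1 ∧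
        θ ∈ Set.Icc (0 : ℝ) 1 ∧ (Set.Icc α β ∩ Set.Icc δ θ).Subsingleton) ∧
      (∀ π ∈ Set.Icc (0 : ℝ) 1,
        actionCost c₁ c₀ C (fourThreshold α β δ θ π) (beliefVec π) = minCost c₁ c₀ C (beliefVec π)) ∧
      ((∀ b, C b = min (∑ h, c₁ h * b h) (∑ h, c₀ h * b h)) →
        Set.Icc α β ∪ Set.Icc δ θ = Set.Icc 0 1) := by
  obtain ⟨α, hα, β, hβ, hI⟩ := exists_Icc_eq_stopRegion c₁ c₀ hC
  by_cases hc : c₁ = c₀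
  · subst hc
    refine ⟨α, β, 1, 0, ⟨hα, hβ, by simp, by simp, by simp⟩, fun π hπ => ?_, fun hC' => ?_⟩
    · simp only [fourThreshold, hI, mem_stopRegion]
      split_ifs with h1 h2
      · simp only [actionCost, minCost, min_self, min_eq_left h1.2.2]
      · exact absurd (h2.1.trans h2.2) (by norm_num)
      · have hlt : C (beliefVec π) < ∑ h, c₁ h * beliefVec π h := by
          by_contra hlt
          exact h1 ⟨hπ, le_rfl, not_lt.mp hlt⟩
        simp only [actionCost, minCost, min_self, min_eq_right hlt.le]
    · rw [hI]
      simp only [zero_lt_one, Set.Icc_eq_empty_of_lt, Set.union_empty]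
      ext π
      rw [mem_stopRegion, hC', min_self]
      exact ⟨fun h => h.1, fun h => ⟨h, le_rfl, le_rfl⟩⟩
  · obtain ⟨δ, hδ, θ, hθ, hI'⟩ := exists_Icc_eq_stopRegion c₀ c₁ hC
    refine ⟨α, β, δ, θ, ⟨hα, hβ, hδ, hθ, ?_⟩, fun π hπ => ?_, fun hC' => ?_⟩
    · rw [hI, hI']
      intro x hx y hy
      by_contra hxy
      exact hc (linear_beliefVec_eq_of_two hxy (le_antisymm hx.1.2.1 hx.2.2.1)
        (le_antisymm hy.1.2.1 hy.2.2.1))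
    · simp only [fourThreshold, hI, hI', mem_stopRegion]
      split_ifs with h1 h2
      · simp only [actionCost, minCost, min_eq_left h1.2.1, min_eq_left h1.2.2]
      · simp only [actionCost, minCost, min_eq_right h2.2.1, min_eq_left h2.2.2]
      · refine (min_eq_right ?_).symm
        refine le_min (not_lt.mp fun hlt => ?_) (not_lt.mp fun hlt => ?_)
        · rcases le_total (∑ h, c₁ h * beliefVec π h) (∑ h, c₀ h * beliefVec π h) with h | h
          · exact h1 ⟨hπ, h, hlt.le⟩
          · exact h2 ⟨hπ, h, h.trans hlt.le⟩
        · rcases le_total (∑ h, c₁ h * beliefVec π h) (∑ h, c₀ h * beliefVec π h) with h | h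
          · exact h1 ⟨hπ, h, h.trans hlt.le⟩
          · exact h2 ⟨hπ, h, hlt.le⟩
    · rw [hI, hI']
      ext π
      simp only [Set.mem_union, mem_stopRegion, hC', le_min_iff, le_refl, true_and, and_true]
      constructor
      · rintro (h | h) <;> exact h.1
      · intro hπ
        rcases le_total (∑ h, c₁ h * beliefVec π h) (∑ h, c₀ h * beliefVec π h) with h | h
        · exact Or.inl ⟨hπ, h, h⟩
        · exact Or.inr ⟨hπ, h, h⟩

/-- The probability of the hypothesis `0` under the unnormalized belief `b`. It is `0` for
`b = 0`. -/
noncomputable def normBelief (b : Fin 2 → ℝ) : ℝ := b 0 / (b 0 + b 1)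

theorem measurable_normBelief : Measurable normBelief := by
  unfold normBelief
  fun_prop

theorem normBelief_mem_Icc {b : Fin 2 → ℝ} (hb : 0 ≤ b) : normBelief b ∈ Set.Icc (0 : ℝ) 1 :=
  ⟨div_nonneg (hb 0) (add_nonneg (hb 0) (hb 1)),
    div_le_one_of_le₀ (le_add_of_nonneg_right (hb 1)) (add_nonneg (hb 0) (hb 1))⟩

theorem normBelief_mul_add {b : Fin 2 → ℝ} (hb : 0 ≤ b) : normBelief b * (b 0 + b 1) = b 0 := by
  rcases eq_or_ne (b 0 + b 1) 0 with h | h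
  · rw [h, mul_zero]
    have := hb 0
    have := hb 1
    simp only [Pi.zero_apply] at *
    linarith
  · exact div_mul_cancel₀ _ h

theorem smul_beliefVec_normBelief {b : Fin 2 → ℝ} (hb : 0 ≤ b) :
    (b 0 + b 1) • beliefVec (normBelief b) = b := by
  have h := normBelief_mul_add hb
  funext k
  fin_cases k
  · simpa [beliefVec, mul_comm] using h
  · simp only [beliefVec, Pi.smul_apply, smul_eq_mul, Fin.mk_one, Matrix.cons_val_one,
      Matrix.cons_val_fin_one]
    linear_combination -h

/-- By homogeneity, an action that is optimal at the normalized belief is optimal at the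
unnormalized one. -/
theorem actionCost_eq_minCost_of_normBelief {c₁ c₀ : Fin 2 → ℝ} {C : (Fin 2 → ℝ) → ℝ}
    (hC : IsCostToGo C) {b : Fin 2 → ℝ} (hb : 0 ≤ b) {m : Msg}
    (hm : actionCost c₁ c₀ C m (beliefVec (normBelief b))
      = minCost c₁ c₀ C (beliefVec (normBelief b))) :
    actionCost c₁ c₀ C m b = minCost c₁ c₀ C b := by
  have hs : 0 ≤ b 0 + b 1 := add_nonneg (hb 0) (hb 1)
  rw [← smul_beliefVec_normBelief hb, (isCostToGo_actionCost c₁ c₀ hC m).homogeneous _ hs,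
    (isCostToGo_minCost c₁ c₀ hC).homogeneous _ hs, hm]

/-! ### The dynamic program of a single sensor -/

instance : DecidableEq Msg := fun a b => by
  cases a <;> cases b <;> first | exact isTrue rfl | exact isFalse (by simp)

instance : Fintype Msg := ⟨{Msg.one, Msg.zero, Msg.blank}, by rintro (_ | _ | _) <;> simp⟩

instance : DiscreteMeasurableSpace Msg := ⟨fun _ => trivial⟩

theorem measurable_fourThreshold (α β δ θ : ℝ) : Measurable (fourThreshold α β δ θ) :=
  Measurable.ite measurableSet_Icc measurable_const
    (Measurable.ite measurableSet_Icc measurable_const measurable_const)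

theorem Msg.sum_univ {M : Type*} [AddCommMonoid M] (F : Msg → M) :
    ∑ m, F m = F Msg.one + F Msg.zero + F Msg.blank := by
  change ∑ m ∈ ({Msg.one, Msg.zero, Msg.blank} : Finset Msg), F m = _
  rw [Finset.sum_insert (by simp), Finset.sum_insert (by simp), Finset.sum_singleton, add_assoc]

/-- The part of a message history before the time `t` that lies before the time `s ≤ t`. -/
def cutHist {𝒱 : Type*} {s t : ℕ} (hst : s ≤ t) (r : Finset.Ico 1 t → 𝒱) : Finset.Ico 1 s → 𝒱 :=
  fun k => r ⟨k.1, Finset.Ico_subset_Ico_right hst k.2⟩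

/-- The observations for which the decision rules `rule` lead to no decision before `t`, if the
message history is `r`. -/
def contSet {𝒱 E : Type*} (rule : ∀ t : ℕ, (Finset.Icc 1 t → E) → (Finset.Ico 1 t → 𝒱) → Msg)
    (t : ℕ) (r : Finset.Ico 1 t → 𝒱) : Set (ℕ → E) :=
  {z | ∀ s : Finset.Ico 1 t, rule s.1 (fun k => z k) (cutHist (Finset.mem_Ico.mp s.2).2.le r)
    = Msg.blank}

/-- The observations for which the decision rules `rule` lead to no decision before `t` and to the
action `m` at `t`, if the message history is `r`. -/
def actSet {𝒱 E : Type*} (rule : ∀ t : ℕ, (Finset.Icc 1 t → E) → (Finset.Ico 1 t → 𝒱) → Msg)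
    (t : ℕ) (r : Finset.Ico 1 t → 𝒱) (m : Msg) : Set (ℕ → E) :=
  {z | z ∈ contSet rule t r ∧ rule t (fun k => z k) r = m}

theorem contSet_one {𝒱 E : Type*}
    (rule : ∀ t : ℕ, (Finset.Icc 1 t → E) → (Finset.Ico 1 t → 𝒱) → Msg) (r : Finset.Ico 1 1 → 𝒱) : contSet rule 1 r = Set.univ :=
  Set.eq_univ_of_forall fun _ s => absurd s.2 (by simp)

theorem actSet_blank {𝒱 E : Type*}
    (rule : ∀ t : ℕ, (Finset.Icc 1 t → E) → (Finset.Ico 1 t → 𝒱) → Msg) {t : ℕ}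
    (ht : 1 ≤ t) (r : Finset.Ico 1 (t + 1) → 𝒱) :
    actSet rule t (cutHist t.le_succ r) Msg.blank = contSet rule (t + 1) r := by
  ext z
  constructor
  · rintro ⟨h1, h2⟩ s
    rcases (Nat.lt_succ_iff.mp (Finset.mem_Ico.mp s.2).2).eq_or_lt with h | h
    · obtain ⟨s, hs⟩ := s
      obtain rfl : s = t := h
      exact h2
    · exact h1 ⟨s.1, Finset.mem_Ico.mpr ⟨(Finset.mem_Ico.mp s.2).1, h⟩⟩
  · intro h
    exact ⟨fun s => h ⟨s.1, Finset.Ico_subset_Ico_right t.le_succ s.2⟩,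
      h ⟨t, Finset.mem_Ico.mpr ⟨ht, t.lt_succ_self⟩⟩⟩

theorem exists_actSet_eq {𝒱 E : Type*} [MeasurableSpace E]
    {rule : ∀ t : ℕ, (Finset.Icc 1 t → E) → (Finset.Ico 1 t → 𝒱) → Msg}
    (hrule : ∀ t r, Measurable fun y => rule t y r) (t : ℕ)
    (r : Finset.Ico 1 t → 𝒱) (m : Msg) :
    ∃ A, MeasurableSet A ∧ actSet rule t r m = {z | (fun s : Finset.Icc 1 t => z s) ∈ A} := by
  refine ⟨{y | (∀ s : Finset.Ico 1 t, rule s.1 (fun k => y ⟨k.1, Finset.Icc_subset_Icc_right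
    (Finset.mem_Ico.mp s.2).2.le k.2⟩) (cutHist (Finset.mem_Ico.mp s.2).2.le r) = Msg.blank) ∧
    rule t y r = m}, ?_, rfl⟩
  refine MeasurableSet.inter ?_ (hrule t r (measurableSet_singleton m))
  refine MeasurableSet.congr (s := ⋂ s : Finset.Ico 1 t, {y | rule s.1 (fun k => y ⟨k.1,
    Finset.Icc_subset_Icc_right (Finset.mem_Ico.mp s.2).2.le k.2⟩)
    (cutHist (Finset.mem_Ico.mp s.2).2.le r) = Msg.blank}) (MeasurableSet.iInter fun s => ?_)
    (Set.ext fun y => by simp only [Set.mem_iInter]; rfl)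
  refine ((hrule s.1 _).comp ?_) (measurableSet_singleton Msg.blank)
  fun_prop

theorem measurableSet_actSet {𝒱 E : Type*} [MeasurableSpace E]
    {rule : ∀ t : ℕ, (Finset.Icc 1 t → E) → (Finset.Ico 1 t → 𝒱) → Msg}
    (hrule : ∀ t r, Measurable fun y => rule t y r) (t : ℕ)
    (r : Finset.Ico 1 t → 𝒱) (m : Msg) :
    MeasurableSet (actSet rule t r m) := by
  obtain ⟨A, hA, h⟩ := exists_actSet_eq hrule t r m
  rw [h]
  exact (show Measurable fun (z : ℕ → E) (s : Finset.Icc 1 t) => z s by fun_prop) hA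

/-- The decision problem of one sensor whose observations `E` are independent over time given the
hypothesis, and which receives at each time a message in `𝒱` whose law is not affected by the
sensor as long as it has not stopped. Observations at time `t` have the reference law `ref t` and
under the hypothesis `h` the density `lik t · h`; `weight t r h` is the probability of the
hypothesis `h` together with the message history `r`, and `stopCost d t r h` is the conditional
expected cost of the decision `d` at time `t` given both. -/
structure DetectionProblem (𝒱 E : Type*) [MeasurableSpace E] where
  ref : ℕ → Measure E
  lik : ℕ → E → Fin 2 → ℝ
  weight : ∀ t : ℕ, (Finset.Ico 1 t → 𝒱) → Fin 2 → ℝ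
  stopCost : Msg → ∀ t : ℕ, (Finset.Ico 1 t → 𝒱) → Fin 2 → ℝ
  isProbabilityMeasure_ref : ∀ t, IsProbabilityMeasure (ref t)
  measurable_lik : ∀ t, Measurable (lik t)
  lik_nonneg : ∀ t x, 0 ≤ lik t x
  integrable_lik : ∀ t, Integrable (lik t) (ref t)
  weight_nonneg : ∀ t r, 0 ≤ weight t r
  weight_eq_zero : ∀ t r h, weight t (cutHist t.le_succ r) h = 0 → weight (t + 1) r h = 0

namespace DetectionProblem

variable {𝒱 E : Type*} [MeasurableSpace E] (D : DetectionProblem 𝒱 E)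

attribute [instance] isProbabilityMeasure_ref

/-- The law of an observation sequence under which the observations are independent with the
reference laws. -/
noncomputable def refLaw : Measure (ℕ → E) := Measure.infinitePi D.ref

instance : IsProbabilityMeasure D.refLaw := by unfold refLaw; infer_instance

/-- The joint density of the observations `y` under the hypothesis `h`. -/
def likProd (t : ℕ) (y : Finset.Icc 1 t → E) (h : Fin 2) : ℝ := ∏ s, D.lik s.1 (y s) h

/-- The unnormalized belief after the observations `y` and the message history `r`. -/
def state (t : ℕ) (y : Finset.Icc 1 t → E) (r : Finset.Ico 1 t → 𝒱) : Fin 2 → ℝ :=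
  D.weight t r * D.likProd t y

/-- The transition probabilities of the received messages; `0` if the history before has
probability `0`. -/
noncomputable def trans (t : ℕ) (r : Finset.Ico 1 (t + 1) → 𝒱) : Fin 2 → ℝ :=
  D.weight (t + 1) r / D.weight t (cutHist t.le_succ r)

theorem measurable_likProd (t : ℕ) : Measurable (D.likProd t) := by
  unfold likProd
  refine measurable_pi_lambda _ fun h => Finset.measurable_prod _ fun s _ => ?_
  exact (measurable_pi_apply h).comp ((D.measurable_lik s.1).comp (measurable_pi_apply s))

theorem measurable_state (t : ℕ) (r : Finset.Ico 1 t → 𝒱) :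
    Measurable fun y => D.state t y r := by
  have := D.measurable_likProd t
  unfold state
  fun_prop

theorem likProd_nonneg (t : ℕ) (y : Finset.Icc 1 t → E) : 0 ≤ D.likProd t y :=
  fun h => Finset.prod_nonneg fun s _ => D.lik_nonneg s.1 (y s) h

theorem state_nonneg (t : ℕ) (y : Finset.Icc 1 t → E) (r : Finset.Ico 1 t → 𝒱) :
    0 ≤ D.state t y r :=
  mul_nonneg (D.weight_nonneg t r) (D.likProd_nonneg t y)

theorem likProd_succ (t : ℕ) (z : ℕ → E) :
    D.likProd (t + 1) (fun s => z s) = D.likProd t (fun s => z s) * D.lik (t + 1) (z (t + 1)) := by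
  funext h
  simp only [likProd, Pi.mul_apply]
  rw [Finset.prod_coe_sort (Finset.Icc 1 (t + 1)) fun s => D.lik s (z s) h,
    Finset.prod_coe_sort (Finset.Icc 1 t) fun s => D.lik s (z s) h,
    Finset.prod_Icc_succ_top (Nat.le_add_left 1 t)]

theorem state_succ (t : ℕ) (z : ℕ → E) (r : Finset.Ico 1 (t + 1) → 𝒱) :
    D.state (t + 1) (fun s => z s) r
      = D.state t (fun s => z s) (cutHist t.le_succ r) *
        (D.trans t r * D.lik (t + 1) (z (t + 1))) := by
  have key : D.weight (t + 1) r = D.weight t (cutHist t.le_succ r) * D.trans t r := by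
    funext h
    exact (mul_div_cancel_of_imp' (D.weight_eq_zero t r h)).symm
  unfold state
  rw [likProd_succ, key]
  ring

/-- Under the reference law the next observation is independent of the previous ones. -/
theorem map_prodMk_refLaw (t : ℕ) :
    D.refLaw.map (fun z => ((fun s : Finset.Icc 1 t => z s), z (t + 1)))
      = (D.refLaw.map fun z (s : Finset.Icc 1 t) => z s).prod (D.ref (t + 1)) := by
  have hdisj : Disjoint (Finset.Icc 1 t) {t + 1} := by simp
  have h := ((iIndepFun_infinitePi (P := D.ref) (X := fun _ x => x)
    (fun _ => measurable_id)).indepFun_finset _ _ hdisj fun s => measurable_pi_apply s).comp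
    measurable_id (measurable_pi_apply (⟨t + 1, Finset.mem_singleton_self _⟩ : ({t + 1} : Finset ℕ)))
  have h2 := (indepFun_iff_map_prod_eq_prod_map_map (Measurable.aemeasurable (by fun_prop))
    (Measurable.aemeasurable (by fun_prop))).mp h
  have h3 : D.ref (t + 1) = D.refLaw.map fun z => z (t + 1) :=
    (Measure.infinitePi_map_eval D.ref (t + 1)).symm
  rw [h3]
  exact h2

theorem integrable_likProd (t : ℕ) :
    Integrable (fun z : ℕ → E => D.likProd t fun s => z s) D.refLaw := by
  induction t with
  | zero =>
    have : (fun z : ℕ → E => D.likProd 0 fun s => z s) = fun _ => 1 := by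
      funext z h
      exact Finset.prod_eq_one fun s _ => absurd s.2 (by simp)
    rw [this]
    exact integrable_const _
  | succ t ih =>
    refine Integrable.of_eval fun h => ?_
    simp only [likProd_succ, Pi.mul_apply]
    have hm : Measurable fun z : ℕ → E => ((fun s : Finset.Icc 1 t => z s), z (t + 1)) := by
      fun_prop
    have h2 : Integrable (fun y => D.likProd t y h) (D.refLaw.map fun z (s : Finset.Icc 1 t) => z s) :=
      (integrable_map_measure (by
        exact ((measurable_pi_apply h).comp (D.measurable_likProd t)).aestronglyMeasurable)
        (Measurable.aemeasurable (by fun_prop))).mpr (ih.eval h)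
    have h3 := h2.mul_prod ((D.integrable_lik (t + 1)).eval h)
    rw [← map_prodMk_refLaw] at h3
    exact h3.comp_measurable hm

theorem integrable_state (t : ℕ) (r : Finset.Ico 1 t → 𝒱) :
    Integrable (fun z : ℕ → E => D.state t (fun s => z s) r) D.refLaw :=
  IsCostToGo.integrable_mul_left (D.integrable_likProd t) _

theorem integrable_trans_mul_lik (t : ℕ) (r : Finset.Ico 1 (t + 1) → 𝒱) :
    Integrable (fun x => D.trans t r * D.lik (t + 1) x) (D.ref (t + 1)) :=
  IsCostToGo.integrable_mul_left (D.integrable_lik (t + 1)) _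

variable [Fintype 𝒱]

open scoped Classical in
/-- The cost of continuing at time `t` when `n` more decisions can be taken, as a function of the
unnormalized belief, if the later decisions are optimal. If no further decision can be taken, it
is set to the cost of the better decision, so that continuing never pays off strictly. -/
noncomputable def contCost : ℕ → ∀ t : ℕ, (Finset.Ico 1 t → 𝒱) → (Fin 2 → ℝ) → ℝ
  | 0, t, r => fun b =>
      min (∑ h, D.stopCost Msg.one t r h * b h) (∑ h, D.stopCost Msg.zero t r h * b h)
  | n + 1, t, r => fun b => ∑ r' with cutHist t.le_succ r' = r, ∫ x,
      minCost (D.stopCost Msg.one (t + 1) r') (D.stopCost Msg.zero (t + 1) r')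
        (contCost n (t + 1) r') (b * (D.trans t r' * D.lik (t + 1) x)) ∂D.ref (t + 1)

/-- The cost of the action `m` when the later decisions are optimal. -/
noncomputable def actCost (n t : ℕ) (r : Finset.Ico 1 t → 𝒱) : Msg → (Fin 2 → ℝ) → ℝ :=
  actionCost (D.stopCost Msg.one t r) (D.stopCost Msg.zero t r) (D.contCost n t r)

/-- The optimal cost-to-go. -/
noncomputable def optCost (n t : ℕ) (r : Finset.Ico 1 t → 𝒱) : (Fin 2 → ℝ) → ℝ :=
  minCost (D.stopCost Msg.one t r) (D.stopCost Msg.zero t r) (D.contCost n t r)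

theorem isCostToGo_contCost (n : ℕ) :
    ∀ t (r : Finset.Ico 1 t → 𝒱), IsCostToGo (D.contCost n t r) := by
  induction n with
  | zero => exact fun t r => (IsCostToGo.linear _).min (.linear _)
  | succ n ih =>
    exact fun t r => .finset_sum _ fun r' =>
      (isCostToGo_minCost _ _ (ih (t + 1) r')).integral_mul (D.integrable_trans_mul_lik t r')

theorem isCostToGo_actCost (n t : ℕ) (r : Finset.Ico 1 t → 𝒱) (m : Msg) :
    IsCostToGo (D.actCost n t r m) :=
  isCostToGo_actionCost _ _ (D.isCostToGo_contCost n t r) m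

theorem isCostToGo_optCost (n t : ℕ) (r : Finset.Ico 1 t → 𝒱) : IsCostToGo (D.optCost n t r) :=
  isCostToGo_minCost _ _ (D.isCostToGo_contCost n t r)

open scoped Classical in
/-- The Bellman equation, integrated over an event that is determined by the observations up to
time `t`. -/
theorem setIntegral_contCost_succ (n t : ℕ) (r : Finset.Ico 1 t → 𝒱) {A : Set (Finset.Icc 1 t → E)}
    (hA : MeasurableSet A) :
    ∫ z in {z | (fun s : Finset.Icc 1 t => z s) ∈ A},
        D.contCost (n + 1) t r (D.state t (fun s => z s) r) ∂D.refLaw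
      = ∑ r' with cutHist t.le_succ r' = r, ∫ z in {z | (fun s : Finset.Icc 1 t => z s) ∈ A},
        D.optCost n (t + 1) r' (D.state (t + 1) (fun s => z s) r') ∂D.refLaw := by
  have hm1 : Measurable fun (z : ℕ → E) (s : Finset.Icc 1 t) => z s := by fun_prop
  have hm : Measurable fun z : ℕ → E => ((fun s : Finset.Icc 1 t => z s), z (t + 1)) := by
    fun_prop
  set Λ := D.refLaw.map fun z (s : Finset.Icc 1 t) => z s with hΛ
  have hprob : IsProbabilityMeasure Λ := Measure.isProbabilityMeasure_map hm1.aemeasurable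
  have hset : {z : ℕ → E | (fun s : Finset.Icc 1 t => z s) ∈ A}
      = (fun z => ((fun s : Finset.Icc 1 t => z s), z (t + 1))) ⁻¹' (A ×ˢ Set.univ) := by
    ext z; simp
  -- the integrand as a function of the observations up to `t` and the observation at `t + 1`
  let F : (Finset.Ico 1 (t + 1) → 𝒱) → (Finset.Icc 1 t → E) × E → ℝ := fun r' p =>
    D.optCost n (t + 1) r' (D.state t p.1 (cutHist t.le_succ r') *
      (D.trans t r' * D.lik (t + 1) p.2))
  have hFm : ∀ r', Measurable (F r') := fun r' => by
    refine (D.isCostToGo_optCost n (t + 1) r').continuous.measurable.comp ?_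
    have h1 : Measurable fun p : (Finset.Icc 1 t → E) × E =>
        D.state t p.1 (cutHist t.le_succ r') := (D.measurable_state t _).comp measurable_fst
    have h2 : Measurable fun p : (Finset.Icc 1 t → E) × E => D.lik (t + 1) p.2 :=
      (D.measurable_lik (t + 1)).comp measurable_snd
    exact h1.mul (h2.const_mul _)
  have hFz : ∀ r' (z : ℕ → E), D.optCost n (t + 1) r' (D.state (t + 1) (fun s => z s) r')
      = F r' ((fun s => z s), z (t + 1)) := fun r' z => by rw [state_succ]
  have hFi : ∀ r', Integrable (F r') (Λ.prod (D.ref (t + 1))) := fun r' => by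
    rw [hΛ, ← map_prodMk_refLaw, integrable_map_measure (hFm r').aestronglyMeasurable
      hm.aemeasurable]
    exact ((D.isCostToGo_optCost n (t + 1) r').integrable_comp
      (D.integrable_state (t + 1) r')).congr (Filter.Eventually.of_forall (hFz r'))
  have hR : ∀ r', ∫ z in {z | (fun s : Finset.Icc 1 t => z s) ∈ A},
        D.optCost n (t + 1) r' (D.state (t + 1) (fun s => z s) r') ∂D.refLaw
      = ∫ y in A, ∫ x, F r' (y, x) ∂D.ref (t + 1) ∂Λ := fun r' => by
    simp only [hFz]
    rw [hset, ← setIntegral_map (f := F r') (hA.prod .univ) (hFm r').aestronglyMeasurable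
      hm.aemeasurable, map_prodMk_refLaw, setIntegral_prod _ (hFi r').integrableOn]
    simp
  rw [Finset.sum_congr rfl fun r' _ => hR r', ← integral_finsetSum _ fun r' _ =>
    ((hFi r').integral_prod_left).integrableOn]
  have hcont : Measurable fun y => D.contCost (n + 1) t r (D.state t y r) :=
    (D.isCostToGo_contCost (n + 1) t r).continuous.measurable.comp (D.measurable_state t r)
  have := setIntegral_map (μ := D.refLaw) hA hcont.aestronglyMeasurable hm1.aemeasurable
  refine this.symm.trans (setIntegral_congr_fun hA fun y _ => ?_)
  refine Finset.sum_congr rfl fun r' hr' => ?_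
  rw [← (Finset.mem_filter.mp hr').2]
  rfl

/-! ### Verification of the dynamic program -/

variable (rule : ∀ t : ℕ, (Finset.Icc 1 t → E) → (Finset.Ico 1 t → 𝒱) → Msg)

/-- The part of the expected cost that is due to decisions at time `t`. -/
noncomputable def stageCost (t : ℕ) : ℝ :=
  ∑ r : Finset.Ico 1 t → 𝒱,
    ((∫ z in actSet rule t r Msg.one,
        ∑ h, D.stopCost Msg.one t r h * D.state t (fun s => z s) r h ∂D.refLaw)
      + ∫ z in actSet rule t r Msg.zero,
        ∑ h, D.stopCost Msg.zero t r h * D.state t (fun s => z s) r h ∂D.refLaw)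

/-- The expected cost-to-go at time `t` if the action at `t` is taken according to the rule and the
later actions, of which there are at most `n`, are optimal. -/
noncomputable def ruleValue (n t : ℕ) : ℝ :=
  ∑ r : Finset.Ico 1 t → 𝒱, ∑ m, ∫ z in actSet rule t r m,
    D.actCost n t r m (D.state t (fun s => z s) r) ∂D.refLaw

/-- The expected cost-to-go at time `t` if the actions at `t` and later are optimal. -/
noncomputable def optValue (n t : ℕ) : ℝ :=
  ∑ r : Finset.Ico 1 t → 𝒱, ∫ z in contSet rule t r,
    D.optCost n t r (D.state t (fun s => z s) r) ∂D.refLaw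

theorem optValue_one (n : ℕ) : D.optValue rule n 1 =
    ∑ r : Finset.Ico 1 1 → 𝒱, ∫ z, D.optCost n 1 r (D.state 1 (fun s => z s) r) ∂D.refLaw := by
  simp only [optValue, contSet_one, setIntegral_univ]

theorem ruleValue_last (n t : ℕ) (h : ∀ y r, rule t y r ≠ Msg.blank) :
    D.ruleValue rule n t = D.stageCost rule t := by
  refine Finset.sum_congr rfl fun r _ => ?_
  have h0 : actSet rule t r Msg.blank = ∅ :=
    Set.eq_empty_of_forall_notMem fun z hz => h _ _ hz.2
  rw [Msg.sum_univ, h0, setIntegral_empty, add_zero]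
  rfl

variable {rule} (hrule : ∀ t r, Measurable fun y => rule t y r)
include hrule

theorem optValue_eq (n t : ℕ) : D.optValue rule n t =
    ∑ r : Finset.Ico 1 t → 𝒱, ∑ m, ∫ z in actSet rule t r m,
      D.optCost n t r (D.state t (fun s => z s) r) ∂D.refLaw := by
  refine Finset.sum_congr rfl fun r _ => ?_
  have hU : contSet rule t r = ⋃ m, actSet rule t r m := by
    ext z
    simp [actSet]
  rw [hU, integral_iUnion_fintype (measurableSet_actSet hrule t r)]
  · intro m m' hm
    refine Set.disjoint_left.mpr fun z hz hz' => hm (hz.2.symm.trans hz'.2)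
  · exact fun m => ((D.isCostToGo_optCost n t r).integrable_comp
      (D.integrable_state t r)).integrableOn

theorem optValue_le_ruleValue (n t : ℕ) : D.optValue rule n t ≤ D.ruleValue rule n t := by
  rw [D.optValue_eq hrule]
  refine Finset.sum_le_sum fun r _ => Finset.sum_le_sum fun m _ => ?_
  exact integral_mono
    ((D.isCostToGo_optCost n t r).integrable_comp (D.integrable_state t r)).integrableOn
    ((D.isCostToGo_actCost n t r m).integrable_comp (D.integrable_state t r)).integrableOn
    fun z => minCost_le_actionCost _ _ _ _ m

theorem ruleValue_eq_optValue (n t : ℕ)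
    (h : ∀ y r, D.actCost n t r (rule t y r) (D.state t y r) = D.optCost n t r (D.state t y r)) :
    D.ruleValue rule n t = D.optValue rule n t := by
  rw [D.optValue_eq hrule]
  refine Finset.sum_congr rfl fun r _ => Finset.sum_congr rfl fun m _ => ?_
  refine setIntegral_congr_fun (measurableSet_actSet hrule t r m) fun z hz => ?_
  rw [← hz.2]
  exact h _ r

theorem ruleValue_succ (n : ℕ) {t : ℕ} (ht : 1 ≤ t) :
    D.ruleValue rule (n + 1) t = D.stageCost rule t + D.optValue rule n (t + 1) := by
  classical
  have hb : D.optValue rule n (t + 1) = ∑ r : Finset.Ico 1 t → 𝒱,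
      ∫ z in actSet rule t r Msg.blank,
        D.contCost (n + 1) t r (D.state t (fun s => z s) r) ∂D.refLaw := by
    rw [optValue, ← Finset.sum_fiberwise _ (cutHist t.le_succ)]
    refine Finset.sum_congr rfl fun r _ => ?_
    obtain ⟨A, hA, h⟩ := exists_actSet_eq hrule t r Msg.blank
    rw [h, D.setIntegral_contCost_succ n t r hA, ← h]
    refine Finset.sum_congr (by congr) fun r' hr' => ?_
    rw [← actSet_blank rule ht, (Finset.mem_filter.mp hr').2]
  rw [hb, ruleValue, stageCost, ← Finset.sum_add_distrib]
  exact Finset.sum_congr rfl fun r _ => Msg.sum_univ _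

/-- The expected cost of a strategy is the optimal cost plus the losses at the single times. -/
theorem sum_stageCost {T : ℕ} (hT : 1 ≤ T) (h : ∀ y r, rule T y r ≠ Msg.blank) :
    ∑ t ∈ Finset.Icc 1 T, D.stageCost rule t = D.optValue rule (T - 1) 1
      + ∑ t ∈ Finset.Icc 1 T, (D.ruleValue rule (T - t) t - D.optValue rule (T - t) t) := by
  have key : ∀ t, 1 ≤ t → t ≤ T → ∑ s ∈ Finset.Ico 1 t, D.stageCost rule s
      + D.optValue rule (T - t) t = D.optValue rule (T - 1) 1
      + ∑ s ∈ Finset.Ico 1 t, (D.ruleValue rule (T - s) s - D.optValue rule (T - s) s) := by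
    intro t ht
    induction t, ht using Nat.le_induction with
    | base => simp
    | succ t ht ih =>
      intro htT
      have hsub : T - t = (T - (t + 1)) + 1 := by omega
      rw [Finset.sum_Ico_succ_top ht, Finset.sum_Ico_succ_top ht, ← add_assoc,
        ← ih (by omega), hsub, D.ruleValue_succ hrule _ ht]
      ring
  have hlast := key T hT le_rfl
  rw [← Finset.Ico_insert_right hT, Finset.sum_insert (by simp), Finset.sum_insert (by simp)]
  rw [D.ruleValue_last _ _ T h]
  linarith

/-- A strategy whose rules minimize the cost-to-go at each time is optimal. -/
theorem sum_stageCost_le {T : ℕ} (hT : 1 ≤ T) (h : ∀ y r, rule T y r ≠ Msg.blank)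
    (hopt : ∀ t y r, D.actCost (T - t) t r (rule t y r) (D.state t y r)
      = D.optCost (T - t) t r (D.state t y r))
    {rule' : ∀ t : ℕ, (Finset.Icc 1 t → E) → (Finset.Ico 1 t → 𝒱) → Msg}
    (hrule' : ∀ t r, Measurable fun y => rule' t y r) (h' : ∀ y r, rule' T y r ≠ Msg.blank) :
    ∑ t ∈ Finset.Icc 1 T, D.stageCost rule t ≤ ∑ t ∈ Finset.Icc 1 T, D.stageCost rule' t := by
  rw [D.sum_stageCost hrule hT h, D.sum_stageCost hrule' hT h', optValue_one, optValue_one]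
  refine add_le_add_right (Finset.sum_le_sum fun t _ => ?_) _
  rw [D.ruleValue_eq_optValue hrule _ _ (hopt t), sub_self]
  exact sub_nonneg.mpr (D.optValue_le_ruleValue hrule' _ _)

end DetectionProblem

namespace SensorNetwork

/-! ### Dynamics of the network -/

variable {ι : Type*} (N : SensorNetwork ι) {𝒴 : ι → Type*} [∀ i, MeasurableSpace (𝒴 i)]

theorem decision_of_active {Γ : ∀ j, N.Strategy 𝒴 j} {y : ∀ j, ℕ → 𝒴 j} {t : ℕ} {j : ι}
    (h : ∀ s ∈ Finset.Ico 1 t, N.decision Γ y s j = Msg.blank) :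
    N.decision Γ y t j
      = (Γ j).rule t (fun s => y j s) (fun s k => N.decision Γ y s k) := by
  rw [decision, if_neg]
  rintro ⟨s, hs⟩
  exact hs (h s.1 s.2)

theorem decision_of_not_active {Γ : ∀ j, N.Strategy 𝒴 j} {y : ∀ j, ℕ → 𝒴 j} {t : ℕ} {j : ι}
    (h : ¬ ∀ s ∈ Finset.Ico 1 t, N.decision Γ y s j = Msg.blank) :
    N.decision Γ y t j = Msg.blank := by
  rw [decision, if_pos]
  by_contra hcon
  exact h fun s hs => by_contra fun hne => hcon ⟨⟨s, hs⟩, hne⟩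

/-- Two strategy profiles lead to the same decisions up to time `n` if their rules agree along the
trajectory of the first one. -/
theorem decision_congr {Γ Γ' : ∀ j, N.Strategy 𝒴 j} {y y' : ∀ j, ℕ → 𝒴 j} {n : ℕ}
    (h : ∀ t ∈ Finset.Icc 1 n, ∀ j, (∀ s ∈ Finset.Ico 1 t, N.decision Γ y s j = Msg.blank) →
      (Γ j).rule t (fun s => y j s) (fun s k => N.decision Γ y s k)
        = (Γ' j).rule t (fun s => y' j s) (fun s k => N.decision Γ y s k)) :
    ∀ t ∈ Finset.Icc 1 n, ∀ j, N.decision Γ y t j = N.decision Γ' y' t j := by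
  intro t
  induction t using Nat.strong_induction_on with
  | _ t ih =>
    intro ht j
    have ih' : ∀ s ∈ Finset.Ico 1 t, ∀ k, N.decision Γ y s k = N.decision Γ' y' s k := by
      intro s hs
      rw [Finset.mem_Ico] at hs
      rw [Finset.mem_Icc] at ht
      exact ih s hs.2 (Finset.mem_Icc.mpr ⟨hs.1, hs.2.le.trans ht.2⟩)
    by_cases hact : ∀ s ∈ Finset.Ico 1 t, N.decision Γ y s j = Msg.blank
    · have hact' : ∀ s ∈ Finset.Ico 1 t, N.decision Γ' y' s j = Msg.blank :=
        fun s hs => (ih' s hs j).symm.trans (hact s hs)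
      rw [N.decision_of_active hact', N.decision_of_active hact, h t ht j hact]
      congr 1
      funext s k
      exact ih' s.1 s.2 k
    · have hact' : ¬ ∀ s ∈ Finset.Ico 1 t, N.decision Γ' y' s j = Msg.blank :=
        fun hcon => hact fun s hs => (ih' s hs j).trans (hcon s hs)
      rw [N.decision_of_not_active hact', N.decision_of_not_active hact]

section StopTime

variable (Γ : ∀ j, N.Strategy 𝒴 j) (y : ∀ j, ℕ → 𝒴 j) (j : ι)

theorem exists_decision_ne_blank : ∃ t ∈ Finset.Icc 1 N.T, N.decision Γ y t j ≠ Msg.blank := by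
  by_contra! h
  have hact : ∀ s ∈ Finset.Ico 1 N.T, N.decision Γ y s j = Msg.blank :=
    fun s hs => h s (Finset.Ico_subset_Icc_self hs)
  have hT := h N.T (Finset.mem_Icc.mpr ⟨N.one_le_T, le_rfl⟩)
  rw [N.decision_of_active hact] at hT
  exact (Γ j).stops _ _ hT

theorem stopTime_mem : 1 ≤ N.stopTime Γ y j ∧ N.decision Γ y (N.stopTime Γ y j) j ≠ Msg.blank := by
  obtain ⟨t, ht, h⟩ := N.exists_decision_ne_blank Γ y j
  exact Nat.sInf_mem (s := {t : ℕ | 1 ≤ t ∧ N.decision Γ y t j ≠ Msg.blank})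
    ⟨t, (Finset.mem_Icc.mp ht).1, h⟩

variable {Γ y j} in
theorem stopTime_le {t : ℕ} (ht : 1 ≤ t) (h : N.decision Γ y t j ≠ Msg.blank) :
    N.stopTime Γ y j ≤ t :=
  Nat.sInf_le ⟨ht, h⟩

theorem stopTime_mem_Icc : N.stopTime Γ y j ∈ Finset.Icc 1 N.T := by
  obtain ⟨t, ht, h⟩ := N.exists_decision_ne_blank Γ y j
  rw [Finset.mem_Icc] at ht ⊢
  exact ⟨(N.stopTime_mem Γ y j).1, (N.stopTime_le ht.1 h).trans ht.2⟩

theorem decision_eq_blank_of_lt_stopTime {s : ℕ} (hs : s ∈ Finset.Ico 1 (N.stopTime Γ y j)) :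
    N.decision Γ y s j = Msg.blank := by
  by_contra h
  rw [Finset.mem_Ico] at hs
  exact absurd (N.stopTime_le hs.1 h) (not_le.mpr hs.2)

variable {Γ y j} in
theorem stopTime_eq {t : ℕ} (ht : 1 ≤ t)
    (hact : ∀ s ∈ Finset.Ico 1 t, N.decision Γ y s j = Msg.blank)
    (h : N.decision Γ y t j ≠ Msg.blank) : N.stopTime Γ y j = t := by
  refine (N.stopTime_le ht h).antisymm (not_lt.mp fun hlt => ?_)
  have hmem := N.stopTime_mem Γ y j
  exact hmem.2 (hact _ (Finset.mem_Ico.mpr ⟨hmem.1, hlt⟩))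

end StopTime

/-- The cost depends only on the decisions up to the horizon. -/
theorem cost_congr {Γ Γ' : ∀ j, N.Strategy 𝒴 j} {y y' : ∀ j, ℕ → 𝒴 j} (h : Fin 2)
    (hdec : ∀ t ∈ Finset.Icc 1 N.T, ∀ j, N.decision Γ y t j = N.decision Γ' y' t j) :
    N.cost Γ h y = N.cost Γ' h y' := by
  have hτ : N.stopTime Γ' y' = N.stopTime Γ y := by
    funext j
    have hmem := N.stopTime_mem_Icc Γ y j
    refine N.stopTime_eq (Finset.mem_Icc.mp hmem).1 (fun s hs => ?_) ?_
    · rw [← hdec s _ j]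
      · exact N.decision_eq_blank_of_lt_stopTime Γ y j hs
      · rw [Finset.mem_Ico] at hs
        rw [Finset.mem_Icc] at hmem ⊢
        exact ⟨hs.1, hs.2.le.trans hmem.2⟩
    · rw [← hdec _ hmem j]
      exact (N.stopTime_mem Γ y j).2
  unfold cost
  rw [hτ]
  congr 2
  funext j
  exact hdec _ (N.stopTime_mem_Icc Γ y j) j

theorem measurable_decision (Γ : ∀ j, N.Strategy 𝒴 j) (t : ℕ) :
    ∀ j, Measurable fun y : ∀ j, ℕ → 𝒴 j => N.decision Γ y t j := by
  induction t using Nat.strong_induction_on with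
  | _ t ih =>
    intro j
    simp only [decision.eq_1 N Γ _ t j]
    refine Measurable.ite ?_ measurable_const ?_
    · refine MeasurableSet.congr (s := ⋃ s : Finset.Ico 1 t,
        (fun y : ∀ j, ℕ → 𝒴 j => N.decision Γ y s j) ⁻¹' {Msg.blank}ᶜ)
        (MeasurableSet.iUnion fun s => ?_) (Set.ext fun y => by simp only [Set.mem_iUnion]; rfl)
      exact ih s.1 (Finset.mem_Ico.mp s.2).2 j (MeasurableSet.of_discrete)
    · refine ((Γ j).measurable_rule t).comp (f := fun y : ∀ j, ℕ → 𝒴 j =>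
        (fun s : Finset.Icc 1 t => y j s.1, fun s k => N.decision Γ y s.1 k.1)) ?_
      refine Measurable.prodMk (by fun_prop) ?_
      exact measurable_pi_lambda _ fun s => measurable_pi_lambda _ fun k =>
        ih s.1 (Finset.mem_Ico.mp s.2).2 k.1

/-- The cost is a function of finitely many decisions. -/
theorem exists_cost_eq (Γ : ∀ j, N.Strategy 𝒴 j) (h : Fin 2) :
    ∃ g : (Finset.Icc 1 N.T → ι → Msg) → ℝ,
      ∀ y, N.cost Γ h y = g fun s j => N.decision Γ y s.1 j := by
  have : Function.FactorsThrough (fun y : ∀ j, ℕ → 𝒴 j => N.cost Γ h y)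
      (fun y (s : Finset.Icc 1 N.T) j => N.decision Γ y s.1 j) := fun y y' hy =>
    N.cost_congr h fun t ht j => congrFun (congrFun hy ⟨t, ht⟩) j
  obtain ⟨g, hg⟩ := (Function.factorsThrough_iff _).mp this
  exact ⟨g, fun y => congrFun hg y⟩

theorem measurable_cost [Finite ι] (Γ : ∀ j, N.Strategy 𝒴 j) (h : Fin 2) :
    Measurable fun y : ∀ j, ℕ → 𝒴 j => N.cost Γ h y := by
  obtain ⟨g, hg⟩ := N.exists_cost_eq Γ h
  simp only [hg]
  refine (Measurable.of_discrete (f := g)).comp ?_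
  exact measurable_pi_lambda _ fun s => measurable_pi_lambda _ fun j => N.measurable_decision Γ s.1 j

theorem exists_abs_cost_le [Finite ι] (Γ : ∀ j, N.Strategy 𝒴 j) (h : Fin 2) :
    ∃ K, ∀ y, |N.cost Γ h y| ≤ K := by
  obtain ⟨g, hg⟩ := N.exists_cost_eq Γ h
  obtain ⟨K, hK⟩ := (Set.finite_range fun D => |g D|).bddAbove
  exact ⟨K, fun y => by rw [hg]; exact hK ⟨_, rfl⟩⟩

/-! ### A single sensor with the strategies of the others fixed -/

/-- The strategy of deciding `d` at time `t₀`, regardless of the information. In order to obtain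
a strategy for all arguments, it decides `1` at the horizon if it has not decided before, and
`d = b` is the strategy of waiting until the horizon. -/
def playAt (i : ι) (t₀ : ℕ) (d : Msg) : N.Strategy 𝒴 i where
  rule t _ _ := if t = t₀ ∧ d ≠ Msg.blank then d else if t = N.T then Msg.one else Msg.blank
  measurable_rule _ := measurable_const
  stops _ _ := by
    rw [if_pos (c := N.T = N.T) rfl]
    split_ifs with h
    · exact h.2
    · simp

variable [DecidableEq ι] (Γ : ∀ j, N.Strategy 𝒴 j) (i : ι)

/-- The messages that sensor `i` receives before time `t` as long as it does not stop. They do not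
depend on its observations or its strategy. -/
noncomputable def silentMsgs (y : ∀ j, ℕ → 𝒴 j) (t : ℕ) : N.MsgHist i t :=
  fun s j => N.decision (Function.update Γ i (N.playAt i N.T Msg.blank)) y s.1 j.1

/-- The cost if sensor `i` makes the decision `d` at time `t`. -/
noncomputable def playCost (t : ℕ) (d : Msg) (h : Fin 2) (y : ∀ j, ℕ → 𝒴 j) : ℝ :=
  N.cost (Function.update Γ i (N.playAt i t d)) h y

/-- The observations that lead to the received messages `r` before time `t`, as long as sensor `i`
does not stop. -/
def histEvent (t : ℕ) (r : N.MsgHist i t) : Set (∀ j, ℕ → 𝒴 j) := {y | N.silentMsgs Γ i y t = r}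

theorem decision_playAt_congr (t₀ : ℕ) (d : Msg) {y y' : ∀ j, ℕ → 𝒴 j}
    (h : ∀ j ≠ i, ∀ s ∈ Finset.Icc 1 N.T, y j s = y' j s) :
    ∀ t ∈ Finset.Icc 1 N.T, ∀ j, N.decision (Function.update Γ i (N.playAt i t₀ d)) y t j
      = N.decision (Function.update Γ i (N.playAt i t₀ d)) y' t j := by
  refine N.decision_congr fun t ht j _ => ?_
  rcases eq_or_ne j i with rfl | hj
  · simp only [Function.update_self, playAt]
  · congr 1
    funext s
    exact h j hj s.1 (Finset.Icc_subset_Icc_right (Finset.mem_Icc.mp ht).2 s.2)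

theorem silentMsgs_congr {t : ℕ} (ht : t ≤ N.T) {y y' : ∀ j, ℕ → 𝒴 j}
    (h : ∀ j ≠ i, ∀ s ∈ Finset.Icc 1 N.T, y j s = y' j s) :
    N.silentMsgs Γ i y t = N.silentMsgs Γ i y' t := by
  funext s j
  refine N.decision_playAt_congr Γ i _ _ h s.1 ?_ j.1
  exact Finset.Icc_subset_Icc_right ht (Finset.Ico_subset_Icc_self s.2)

theorem mem_histEvent_congr {t : ℕ} (ht : t ≤ N.T) (r : N.MsgHist i t) {y y' : ∀ j, ℕ → 𝒴 j}
    (h : ∀ j ≠ i, ∀ s ∈ Finset.Icc 1 N.T, y j s = y' j s) :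
    y ∈ N.histEvent Γ i t r ↔ y' ∈ N.histEvent Γ i t r :=
  iff_of_eq (congrArg (· = r) (N.silentMsgs_congr Γ i ht h))

theorem playCost_congr (t : ℕ) (d : Msg) (h' : Fin 2) {y y' : ∀ j, ℕ → 𝒴 j}
    (h : ∀ j ≠ i, ∀ s ∈ Finset.Icc 1 N.T, y j s = y' j s) :
    N.playCost Γ i t d h' y = N.playCost Γ i t d h' y' :=
  N.cost_congr h' (N.decision_playAt_congr Γ i t d h)

theorem measurable_silentMsgs (t : ℕ) : Measurable fun y => N.silentMsgs Γ i y t :=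
  measurable_pi_lambda _ fun s => measurable_pi_lambda _ fun j => N.measurable_decision _ s.1 j.1

theorem measurableSet_histEvent [Finite ι] (t : ℕ) (r : N.MsgHist i t) :
    MeasurableSet (N.histEvent Γ i t r) :=
  N.measurable_silentMsgs Γ i t (measurableSet_singleton r)

variable (γ : N.Strategy 𝒴 i) {y : ∀ j, ℕ → 𝒴 j}

/-- As long as sensor `i` has not stopped, the decisions are those under silence of `i`. -/
theorem decision_eq_silent {t : ℕ} (ht : t ≤ N.T)
    (h : ∀ s ∈ Finset.Ico 1 t, N.decision (Function.update Γ i γ) y s i = Msg.blank) :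
    ∀ s ∈ Finset.Ico 1 t, ∀ j, N.decision (Function.update Γ i γ) y s j
      = N.decision (Function.update Γ i (N.playAt i N.T Msg.blank)) y s j := by
  rcases Nat.eq_zero_or_pos t with rfl | ht0
  · intro s hs
    simp at hs
  have hIco : Finset.Ico 1 t = Finset.Icc 1 (t - 1) := by
    ext s
    simp only [Finset.mem_Ico, Finset.mem_Icc]
    omega
  rw [hIco] at h ⊢
  refine N.decision_congr fun s hs j hact => ?_
  rcases eq_or_ne j i with rfl | hj
  · rw [← N.decision_of_active hact, h s hs]
    have hsT : s ≠ N.T := by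
      rw [Finset.mem_Icc] at hs
      omega
    simp [playAt, hsT]
  · simp only [Function.update_of_ne hj]

theorem received_eq_silentMsgs {t : ℕ} (ht : t ≤ N.T)
    (h : ∀ s ∈ Finset.Ico 1 t, N.decision (Function.update Γ i γ) y s i = Msg.blank) :
    (fun s j => N.decision (Function.update Γ i γ) y s.1 j.1) = N.silentMsgs Γ i y t := by
  funext s j
  exact N.decision_eq_silent Γ i γ ht h s.1 s.2 j.1

theorem decision_playAt_blank {s : ℕ} (hs : s < N.T) :
    N.decision (Function.update Γ i (N.playAt i N.T Msg.blank)) y s i = Msg.blank := by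
  by_cases hact : ∀ k ∈ Finset.Ico 1 s,
      N.decision (Function.update Γ i (N.playAt i N.T Msg.blank)) y k i = Msg.blank
  · rw [N.decision_of_active hact]
    simp [playAt, hs.ne]
  · exact N.decision_of_not_active hact

theorem mem_contSet_iff {t : ℕ} (ht : t ≤ N.T) :
    y i ∈ contSet γ.rule t (N.silentMsgs Γ i y t) ↔
      ∀ s ∈ Finset.Ico 1 t, N.decision (Function.update Γ i γ) y s i = Msg.blank := by
  constructor
  · intro h
    have hlt : ∀ s ∈ Finset.Icc 1 (t - 1), s ∈ Finset.Ico 1 t := fun s hs => by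
      rw [Finset.mem_Icc] at hs
      rw [Finset.mem_Ico]
      omega
    have hdec := N.decision_congr (Γ := Function.update Γ i (N.playAt i N.T Msg.blank))
      (Γ' := Function.update Γ i γ) (y := y) (y' := y) (n := t - 1) fun s hs j _ => by
        rcases eq_or_ne j i with rfl | hj
        · have hs' := hlt s hs
          have hsT : s ≠ N.T := ((Finset.mem_Ico.mp hs').2.trans_le ht).ne
          have := h ⟨s, hs'⟩
          simp only [Function.update_self]
          refine Eq.trans ?_ this.symm
          simp [playAt, hsT]
        · simp only [Function.update_of_ne hj]
    intro s hs
    rw [Finset.mem_Ico] at hs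
    rw [← hdec s (Finset.mem_Icc.mpr (by omega)) i]
    exact N.decision_playAt_blank Γ i (hs.2.trans_le ht)
  · rintro h ⟨s, hs⟩
    have hle := (Finset.mem_Ico.mp hs).2.le
    have hact : ∀ k ∈ Finset.Ico 1 s,
        N.decision (Function.update Γ i γ) y k i = Msg.blank :=
      fun k hk => h k (Finset.Ico_subset_Ico_right hle hk)
    have hb := h s hs
    rw [N.decision_of_active hact, N.received_eq_silentMsgs Γ i γ (hle.trans ht) hact,
      Function.update_self] at hb
    exact hb

theorem mem_actSet_iff {t : ℕ} (ht : t ≤ N.T) (m : Msg) :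
    y i ∈ actSet γ.rule t (N.silentMsgs Γ i y t) m ↔
      (∀ s ∈ Finset.Ico 1 t, N.decision (Function.update Γ i γ) y s i = Msg.blank) ∧
      N.decision (Function.update Γ i γ) y t i = m := by
  refine (and_congr_left' (N.mem_contSet_iff Γ i γ ht)).trans (and_congr_right fun h => ?_)
  rw [N.decision_of_active h, N.received_eq_silentMsgs Γ i γ ht h, Function.update_self]

/-- The cost is determined by the time and the value of the decision of sensor `i` and by the
observations of the others. -/
theorem cost_eq_playCost (h : Fin 2) :
    N.cost (Function.update Γ i γ) h y
      = N.playCost Γ i (N.stopTime (Function.update Γ i γ) y i)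
          (N.decision (Function.update Γ i γ) y (N.stopTime (Function.update Γ i γ) y i) i) h y := by
  set τ := N.stopTime (Function.update Γ i γ) y i with hτ
  have hne := (N.stopTime_mem (Function.update Γ i γ) y i).2
  refine N.cost_congr h (N.decision_congr fun t ht j hact => ?_)
  rcases eq_or_ne j i with rfl | hj
  · rw [← N.decision_of_active hact]
    have htτ : t ≤ τ := not_lt.mp fun hlt => hne
      (hact τ (Finset.mem_Ico.mpr ⟨(N.stopTime_mem (Function.update Γ j γ) y j).1, hlt⟩))
    simp only [Function.update_self, playAt]
    rcases htτ.eq_or_lt with rfl | hlt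
    · rw [if_pos ⟨rfl, hne⟩]
    · have hT : t ≠ N.T :=
        (hlt.trans_le (Finset.mem_Icc.mp (N.stopTime_mem_Icc (Function.update Γ j γ) y j)).2).ne
      rw [if_neg fun hcon => hlt.ne hcon.1, if_neg hT]
      exact N.decision_eq_blank_of_lt_stopTime _ _ _
        (Finset.mem_Ico.mpr ⟨(Finset.mem_Icc.mp ht).1, hlt⟩)
  · simp only [Function.update_of_ne hj]

/-- The cost as a sum over the possible times and values of the decision of sensor `i`, and over
the messages received before. Exactly one summand does not vanish. -/
theorem cost_eq_sum [Fintype (N.Parents i → Msg)] (h : Fin 2) :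
    N.cost (Function.update Γ i γ) h y
      = ∑ t ∈ Finset.Icc 1 N.T, ∑ r : N.MsgHist i t,
        ((actSet γ.rule t r Msg.one).indicator 1 (y i)
            * (N.histEvent Γ i t r).indicator (N.playCost Γ i t Msg.one h) y
          + (actSet γ.rule t r Msg.zero).indicator 1 (y i)
            * (N.histEvent Γ i t r).indicator (N.playCost Γ i t Msg.zero h) y) := by
  classical
  set τ := N.stopTime (Function.update Γ i γ) y i with hτ
  have hτm := N.stopTime_mem_Icc (Function.update Γ i γ) y i
  have hne := (N.stopTime_mem (Function.update Γ i γ) y i).2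
  have hmem : ∀ t ∈ Finset.Icc 1 N.T, ∀ m ≠ Msg.blank,
      y i ∈ actSet γ.rule t (N.silentMsgs Γ i y t) m →
        t = τ ∧ N.decision (Function.update Γ i γ) y t i = m := by
    intro t ht m hm hy
    rw [Finset.mem_Icc] at ht
    obtain ⟨h1, h2⟩ := (N.mem_actSet_iff Γ i γ ht.2 m).mp hy
    exact ⟨(N.stopTime_eq ht.1 h1 (h2 ▸ hm)).symm, h2⟩
  have hτs : y i ∈ actSet γ.rule τ (N.silentMsgs Γ i y τ)
      (N.decision (Function.update Γ i γ) y τ i) :=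
    (N.mem_actSet_iff Γ i γ (Finset.mem_Icc.mp hτm).2 _).mpr
      ⟨fun s hs => N.decision_eq_blank_of_lt_stopTime _ _ _ hs, rfl⟩
  have hin : ∀ t, ∑ r : N.MsgHist i t,
        ((actSet γ.rule t r Msg.one).indicator 1 (y i)
            * (N.histEvent Γ i t r).indicator (N.playCost Γ i t Msg.one h) y
          + (actSet γ.rule t r Msg.zero).indicator 1 (y i)
            * (N.histEvent Γ i t r).indicator (N.playCost Γ i t Msg.zero h) y)
      = (if y i ∈ actSet γ.rule t (N.silentMsgs Γ i y t) Msg.one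
            then N.playCost Γ i t Msg.one h y else 0)
        + if y i ∈ actSet γ.rule t (N.silentMsgs Γ i y t) Msg.zero
            then N.playCost Γ i t Msg.zero h y else 0 := by
    intro t
    rw [Finset.sum_eq_single_of_mem (N.silentMsgs Γ i y t) (Finset.mem_univ _)]
    · simp [Set.indicator_apply, histEvent]
    · intro r _ hr
      have hr' : y ∉ N.histEvent Γ i t r := fun h => hr (Eq.symm h)
      simp [hr']
  rw [Finset.sum_congr rfl fun t _ => hin t, Finset.sum_eq_single_of_mem τ hτm,
    N.cost_eq_playCost]
  · rw [← hτ]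
    have huniq : ∀ m ≠ Msg.blank, m ≠ N.decision (Function.update Γ i γ) y τ i →
        y i ∉ actSet γ.rule τ (N.silentMsgs Γ i y τ) m :=
      fun m hm hmd hy => hmd (hmem τ hτm m hm hy).2.symm
    generalize N.decision (Function.update Γ i γ) y τ i = d at hτs hne huniq
    cases d
    · rw [if_pos hτs, if_neg (huniq Msg.one (by simp) (by simp)), zero_add]
    · rw [if_pos hτs, if_neg (huniq Msg.zero (by simp) (by simp)), add_zero]
    · exact absurd rfl hne
  · intro t ht htτ
    rw [if_neg fun hy => htτ (hmem t ht _ (by simp) hy).1,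
      if_neg fun hy => htτ (hmem t ht _ (by simp) hy).1, add_zero]

end SensorNetwork

/-! ### Densities of product laws and integrals over an event -/

theorem pi_withDensity_eq {κ : Type*} [Fintype κ] {X : κ → Type*} [∀ k, MeasurableSpace (X k)]
    (μ : ∀ k, Measure (X k)) [∀ k, IsProbabilityMeasure (μ k)] {g : ∀ k, X k → ENNReal}
    (hg : ∀ k, Measurable (g k)) [∀ k, SigmaFinite ((μ k).withDensity (g k))] :
    Measure.pi (fun k => (μ k).withDensity (g k))
      = (Measure.pi μ).withDensity fun x => ∏ k, g k (x k) := by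
  refine (Measure.pi_eq fun S hS => ?_)
  have hbox : MeasurableSet (Set.univ.pi S) := MeasurableSet.univ_pi hS
  rw [withDensity_apply _ hbox, ← lintegral_indicator hbox]
  have hind : ∀ x : ∀ k, X k, (Set.univ.pi S).indicator (fun x => ∏ k, g k (x k)) x
      = ∏ k, (S k).indicator (g k) (x k) := by
    intro x
    by_cases hx : x ∈ Set.univ.pi S
    · rw [Set.indicator_of_mem hx]
      exact Finset.prod_congr rfl fun k _ => (Set.indicator_of_mem (hx k trivial) _).symm
    · rw [Set.indicator_of_notMem hx]
      simp only [Set.mem_pi, Set.mem_univ, forall_const, not_forall] at hx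
      obtain ⟨k, hk⟩ := hx
      exact (Finset.prod_eq_zero (Finset.mem_univ k) (Set.indicator_of_notMem hk _)).symm
  simp only [hind]
  have hm : ∀ k, Measurable ((S k).indicator (g k)) := fun k => (hg k).indicator (hS k)
  rw [lintegral_prod_eq_prod_lintegral_of_indepFun Finset.univ
    (fun k (x : ∀ k, X k) => (S k).indicator (g k) (x k))
    (iIndepFun_pi fun k => (hm k).aemeasurable) fun k => (hm k).comp (measurable_pi_apply k)]
  refine Finset.prod_congr rfl fun k _ => ?_
  rw [withDensity_apply _ (hS k), ← lintegral_indicator (hS k)]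
  exact (measurePreserving_eval μ k).lintegral_comp (hm k)

theorem setIntegral_eq_real_mul_integral_cond {Ω : Type*} [MeasurableSpace Ω] {P : Measure Ω}
    [IsFiniteMeasure P] {s : Set Ω} (hs : P s ≠ 0) (F : Ω → ℝ) :
    ∫ ω in s, F ω ∂P = P.real s * ∫ ω, F ω ∂P[|s] := by
  have hr : P.real s ≠ 0 := (measureReal_ne_zero_iff).mpr hs
  rw [ProbabilityTheory.cond, integral_smul_measure, ENNReal.toReal_inv, smul_eq_mul, ← mul_assoc]
  rw [← measureReal_def, mul_inv_cancel₀ hr, one_mul]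

theorem integral_eq_sum_setIntegral_fiber {Ω κ : Type*} [MeasurableSpace Ω] [Fintype κ]
    [MeasurableSpace κ] [MeasurableSingletonClass κ] {P : Measure Ω} {X : Ω → κ}
    (hX : Measurable X) {F : κ → Ω → ℝ} (hF : ∀ k, Integrable (F k) P) :
    ∫ ω, F (X ω) ω ∂P = ∑ k, ∫ ω in X ⁻¹' {k}, F k ω ∂P := by
  have hU : (⋃ k, X ⁻¹' {k}) = Set.univ := by
    ext ω
    simp
  have hms : ∀ k, MeasurableSet (X ⁻¹' {k}) := fun k => hX (measurableSet_singleton k)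
  have heq : ∀ k, Set.EqOn (fun ω => F (X ω) ω) (F k) (X ⁻¹' {k}) := fun k ω hω => by
    rw [← show X ω = k from hω]
  rw [← setIntegral_univ, ← hU, integral_iUnion_fintype hms]
  · exact Finset.sum_congr rfl fun k _ => setIntegral_congr_fun (hms k) (heq k)
  · intro k k' hk
    exact Set.disjoint_left.mpr fun ω hω hω' => hk (hω.symm.trans hω')
  · exact fun k => (integrableOn_congr_fun (heq k) (hms k)).mpr (hF k).integrableOn

namespace SensorNetwork

/-! ### The decision problem of a sensor in the network -/

variable {ι : Type*} (N : SensorNetwork ι) {𝒴 : ι → Type*} [∀ i, MeasurableSpace (𝒴 i)]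
  {Ω : Type*} [MeasurableSpace Ω]

theorem measurable_observations {Y : ∀ i, ℕ → Ω → 𝒴 i} (hY : ∀ i t, Measurable (Y i t)) :
    Measurable fun ω j s => Y j s ω :=
  measurable_pi_lambda _ fun j => measurable_pi_lambda _ fun s => hY j s

variable {N} in
theorem Strategy.measurable_rule_left {i : ι} (γ : N.Strategy 𝒴 i) (t : ℕ) (r : N.MsgHist i t) :
    Measurable fun y => γ.rule t y r :=
  (γ.measurable_rule t).comp (measurable_id.prodMk measurable_const)

variable [DecidableEq ι]

/-- The decision problem of sensor `i` with the strategies of the others fixed. The reference laws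
are the unconditional laws of the observations; they dominate the conditional laws given `H = h`,
also if `H = h` has probability `0`, when `P[|H ⁻¹' {h}]` is the zero measure. For a message history
of weight `0` the quotient `stopCost` is `0`, and its value is irrelevant. -/
noncomputable def problem (P : Measure Ω) [IsProbabilityMeasure P] (H : Ω → Fin 2)
    (Y : ∀ i, ℕ → Ω → 𝒴 i) (hY : ∀ i t, Measurable (Y i t)) (Γ : ∀ j, N.Strategy 𝒴 j) (i : ι) :
    DetectionProblem (N.Parents i → Msg) (𝒴 i) where
  ref t := P.map (Y i t)
  lik t x h := ((P[|H ⁻¹' {h}].map (Y i t)).rnDeriv (P.map (Y i t)) x).toReal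
  weight t r h := P.real (H ⁻¹' {h} ∩ (fun ω j s => Y j s ω) ⁻¹' N.histEvent Γ i t r)
  stopCost d t r h :=
    (∫ ω in H ⁻¹' {h},
        (N.histEvent Γ i t r).indicator (N.playCost Γ i t d h) (fun j s => Y j s ω) ∂P)
      / P.real (H ⁻¹' {h} ∩ (fun ω j s => Y j s ω) ⁻¹' N.histEvent Γ i t r)
  isProbabilityMeasure_ref t := Measure.isProbabilityMeasure_map (hY i t).aemeasurable
  measurable_lik t := measurable_pi_lambda _ fun h => (Measure.measurable_rnDeriv _ _).ennreal_toReal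
  lik_nonneg t x h := ENNReal.toReal_nonneg
  integrable_lik t := Integrable.of_eval fun h => Measure.integrable_toReal_rnDeriv
  weight_nonneg t r h := measureReal_nonneg
  weight_eq_zero t r h h0 := by
    refine le_antisymm (h0 ▸ measureReal_mono ?_) measureReal_nonneg
    rintro ω ⟨h1, h2⟩
    refine ⟨h1, ?_⟩
    rw [← show _ = r from h2]
    rfl

variable {N} {P : Measure Ω} [IsProbabilityMeasure P] {H : Ω → Fin 2} {Y : ∀ i, ℕ → Ω → 𝒴 i}

namespace ObservationModel

/-- Given the hypothesis, the observations of sensor `i` have the product density. -/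
theorem integral_cond_eq (hobs : N.ObservationModel P H Y) (Γ : ∀ j, N.Strategy 𝒴 j) (i : ι)
    {h : Fin 2} (hh : P (H ⁻¹' {h}) ≠ 0) {t : ℕ} (ht : t ≤ N.T)
    {φ : (Finset.Icc 1 t → 𝒴 i) → ℝ} (hφ : Measurable φ) :
    ∫ ω, φ (fun s => Y i s ω) ∂P[|H ⁻¹' {h}]
      = ∫ z, φ (fun s => z s) * (N.problem P H Y hobs.measurable_Y Γ i).likProd t (fun s => z s) h
        ∂(N.problem P H Y hobs.measurable_Y Γ i).refLaw := by
  have hY := hobs.measurable_Y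
  set D := N.problem P H Y hY Γ i with hD
  have hprob : IsProbabilityMeasure P[|H ⁻¹' {h}] := cond_isProbabilityMeasure hh
  have hdens : ∀ s : ℕ, (P[|H ⁻¹' {h}]).map (Y i s)
      = (D.ref s).withDensity fun x => ENNReal.ofReal (D.lik s x h) := by
    intro s
    have hac : (P[|H ⁻¹' {h}]).map (Y i s) ≪ P.map (Y i s) :=
      (cond_absolutelyContinuous).map (hY i s)
    rw [← Measure.withDensity_rnDeriv_eq _ _ hac]
    refine withDensity_congr_ae ?_
    filter_upwards [Measure.rnDeriv_lt_top ((P[|H ⁻¹' {h}]).map (Y i s)) (P.map (Y i s))] with x hx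
    exact (ENNReal.ofReal_toReal hx.ne).symm
  have hlm : ∀ s, Measurable fun x => ENNReal.ofReal (D.lik s x h) := fun s =>
    ((measurable_pi_apply h).comp (D.measurable_lik s)).ennreal_ofReal
  have hm : Measurable fun ω (s : Finset.Icc 1 t) => Y i s ω :=
    measurable_pi_lambda _ fun s => hY i s
  have hind : iIndepFun (fun (s : Finset.Icc 1 t) ω => Y i s.1 ω) P[|H ⁻¹' {h}] :=
    (hobs.indep_time h hh i).precomp (g := fun s : Finset.Icc 1 t =>
      (⟨s.1, Finset.Icc_subset_Icc_right ht s.2⟩ : Finset.Icc 1 N.T))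
      fun s s' hs => Subtype.ext (congrArg (fun x : Finset.Icc 1 N.T => x.1) hs)
  have hsf : ∀ s : Finset.Icc 1 t, SigmaFinite ((D.ref s.1).withDensity
      fun x => ENNReal.ofReal (D.lik s.1 x h)) := fun s => by
    rw [← hdens]
    have := Measure.isProbabilityMeasure_map (μ := P[|H ⁻¹' {h}]) (hY i s.1).aemeasurable
    infer_instance
  have hlaw : (P[|H ⁻¹' {h}]).map (fun ω (s : Finset.Icc 1 t) => Y i s ω)
      = (Measure.pi fun s : Finset.Icc 1 t => D.ref s.1).withDensity
        fun y => ∏ s, ENNReal.ofReal (D.lik s.1 (y s) h) := by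
    rw [(iIndepFun_iff_map_fun_eq_pi_map (f := fun (s : Finset.Icc 1 t) ω => Y i s.1 ω) fun s =>
        (hY i s.1).aemeasurable).mp hind,
      ← pi_withDensity_eq (fun s : Finset.Icc 1 t => D.ref s.1)
        (g := fun s x => ENNReal.ofReal (D.lik s.1 x h)) fun s => hlm s.1]
    exact congrArg Measure.pi (funext fun s => hdens s.1)
  have hres : D.refLaw.map (fun z (s : Finset.Icc 1 t) => z s)
      = Measure.pi fun s : Finset.Icc 1 t => D.ref s.1 :=
    Measure.infinitePi_map_restrict (I := Finset.Icc 1 t) D.ref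
  have hlp : Measurable fun y => φ y * D.likProd t y h :=
    hφ.mul ((measurable_pi_apply h).comp (D.measurable_likProd t))
  have hl := integral_map (μ := P[|H ⁻¹' {h}]) hm.aemeasurable hφ.aestronglyMeasurable
  have hr := integral_map (μ := D.refLaw) (f := fun y => φ y * D.likProd t y h)
    (φ := fun z (s : Finset.Icc 1 t) => z s)
    (Measurable.aemeasurable (by fun_prop)) hlp.aestronglyMeasurable
  rw [← hl, ← hr, hres, hlaw, integral_withDensity_eq_integral_toReal_smul
    (Finset.measurable_prod _ fun s _ => (hlm s.1).comp (measurable_pi_apply s))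
    (Filter.Eventually.of_forall fun y => ENNReal.prod_lt_top fun s _ => ENNReal.ofReal_lt_top)]
  refine integral_congr_ae (Filter.Eventually.of_forall fun y => ?_)
  simp only [ENNReal.toReal_prod, smul_eq_mul]
  rw [mul_comm]
  congr 1
  exact Finset.prod_congr rfl fun s _ => ENNReal.toReal_ofReal (D.lik_nonneg _ _ _)

/-- Given the hypothesis, the observations of sensor `i` are independent of every quantity that is
determined by the observations of the others. -/
theorem indepFun_others [Fintype ι] (hobs : N.ObservationModel P H Y) (i : ι)
    {h : Fin 2} (hh : P (H ⁻¹' {h}) ≠ 0) {t : ℕ} (ht : t ≤ N.T)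
    {φ : (Finset.Icc 1 t → 𝒴 i) → ℝ} (hφ : Measurable φ)
    {ψ : (∀ j, ℕ → 𝒴 j) → ℝ} (hψ : Measurable ψ)
    (hψi : ∀ y y', (∀ j ≠ i, ∀ s ∈ Finset.Icc 1 N.T, y j s = y' j s) → ψ y = ψ y') :
    IndepFun (fun ω => φ fun s => Y i s ω) (fun ω => ψ fun j s => Y j s ω) P[|H ⁻¹' {h}] := by
  classical
  have hY := hobs.measurable_Y
  obtain ⟨ω₀⟩ := P.nonempty_of_neZero
  have hdisj : Disjoint ({i} : Finset ι) {i}ᶜ := disjoint_compl_right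
  -- the observations of the others up to the horizon, extended by constants
  let ext : (∀ j : ({i}ᶜ : Finset ι), Finset.Icc 1 N.T → 𝒴 j) → ∀ j, ℕ → 𝒴 j := fun w j s =>
    if hj : j ∈ ({i}ᶜ : Finset ι) then
      if hs : s ∈ Finset.Icc 1 N.T then w ⟨j, hj⟩ ⟨s, hs⟩ else Y j s ω₀
    else Y j s ω₀
  have hext : Measurable ext := by
    refine measurable_pi_lambda _ fun j => measurable_pi_lambda _ fun s => ?_
    by_cases hj : j ∈ ({i}ᶜ : Finset ι)
    · by_cases hs : s ∈ Finset.Icc 1 N.T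
      · simp only [ext, dif_pos hj, dif_pos hs]
        exact (measurable_pi_apply _).comp (measurable_pi_apply (⟨j, hj⟩ : ({i}ᶜ : Finset ι)))
      · simp only [ext, dif_pos hj, dif_neg hs]
        exact measurable_const
    · simp only [ext, dif_neg hj]
      exact measurable_const
  let own : (∀ j : ({i} : Finset ι), Finset.Icc 1 N.T → 𝒴 j) → Finset.Icc 1 t → 𝒴 i := fun w s =>
    w ⟨i, Finset.mem_singleton_self i⟩ ⟨s.1, Finset.Icc_subset_Icc_right ht s.2⟩
  have hown : Measurable own := measurable_pi_lambda _ fun s =>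
    (measurable_pi_apply _).comp
      (measurable_pi_apply (⟨i, Finset.mem_singleton_self i⟩ : ({i} : Finset ι)))
  have hind := ((hobs.indep_sensor h hh).indepFun_finset _ _ hdisj fun j =>
    measurable_pi_lambda _ fun s => hY j s.1).comp (hφ.comp hown) (hψ.comp hext)
  have heq : (fun ω => ψ fun j s => Y j s ω)
      = fun ω => ψ (ext fun j s => Y j.1 s.1 ω) := by
    funext ω
    refine hψi _ _ fun j hj s hs => ?_
    have hj' : j ∈ ({i}ᶜ : Finset ι) := by simpa using hj
    simp only [ext, dif_pos hj', dif_pos hs]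
  rw [heq]
  exact hind

/-- Expectations of products of a function of the observations of sensor `i` and a quantity
determined by the observations of the others. -/
theorem setIntegral_mul_eq [Fintype ι] (hobs : N.ObservationModel P H Y) (Γ : ∀ j, N.Strategy 𝒴 j)
    (i : ι) (h : Fin 2) {t : ℕ} (ht : t ≤ N.T)
    {φ : (Finset.Icc 1 t → 𝒴 i) → ℝ} (hφ : Measurable φ)
    {ψ : (∀ j, ℕ → 𝒴 j) → ℝ} (hψ : Measurable ψ)
    (hψi : ∀ y y', (∀ j ≠ i, ∀ s ∈ Finset.Icc 1 N.T, y j s = y' j s) → ψ y = ψ y') :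
    ∫ ω in H ⁻¹' {h}, φ (fun s => Y i s ω) * ψ (fun j s => Y j s ω) ∂P
      = (∫ ω in H ⁻¹' {h}, ψ (fun j s => Y j s ω) ∂P) *
        ∫ z, φ (fun s => z s) * (N.problem P H Y hobs.measurable_Y Γ i).likProd t (fun s => z s) h
          ∂(N.problem P H Y hobs.measurable_Y Γ i).refLaw := by
  by_cases hh : P (H ⁻¹' {h}) = 0
  · simp [Measure.restrict_eq_zero.mpr hh]
  · rw [setIntegral_eq_real_mul_integral_cond hh, setIntegral_eq_real_mul_integral_cond hh,
      ← hobs.integral_cond_eq Γ i hh ht hφ,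
      (hobs.indepFun_others i hh ht hφ hψ hψi).integral_fun_mul_eq_mul_integral
        (hφ.comp (measurable_pi_lambda _ fun s => hobs.measurable_Y i s.1)).aestronglyMeasurable
        (hψ.comp (measurable_observations hobs.measurable_Y)).aestronglyMeasurable]
    ring

end ObservationModel

end SensorNetwork

namespace SensorNetwork

variable {ι : Type*} [Fintype ι] [DecidableEq ι] {N : SensorNetwork ι} {𝒴 : ι → Type*}
  [∀ i, MeasurableSpace (𝒴 i)] {Ω : Type*} [MeasurableSpace Ω] {P : Measure Ω}
  [IsProbabilityMeasure P] {H : Ω → Fin 2} {Y : ∀ i, ℕ → Ω → 𝒴 i}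

namespace ObservationModel

/-! ### The expected cost -/

theorem stopCost_mul_weight (hobs : N.ObservationModel P H Y) (Γ : ∀ j, N.Strategy 𝒴 j) (i : ι)
    (d : Msg) (t : ℕ) (r : N.MsgHist i t) (h : Fin 2) :
    (N.problem P H Y hobs.measurable_Y Γ i).stopCost d t r h
        * (N.problem P H Y hobs.measurable_Y Γ i).weight t r h
      = ∫ ω in H ⁻¹' {h},
        (N.histEvent Γ i t r).indicator (N.playCost Γ i t d h) (fun j s => Y j s ω) ∂P := by
  refine div_mul_cancel_of_imp fun h0 => ?_
  have hS : MeasurableSet ((fun ω j s => Y j s ω) ⁻¹' N.histEvent Γ i t r) :=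
    measurable_observations hobs.measurable_Y (N.measurableSet_histEvent Γ i t r)
  change ∫ ω in H ⁻¹' {h}, ((fun ω j s => Y j s ω) ⁻¹' N.histEvent Γ i t r).indicator
    (fun ω => N.playCost Γ i t d h fun j s => Y j s ω) ω ∂P = 0
  rw [setIntegral_indicator hS]
  exact setIntegral_measure_zero _ ((measureReal_eq_zero_iff).mp h0)

theorem setIntegral_actSet_mul (hobs : N.ObservationModel P H Y) (Γ : ∀ j, N.Strategy 𝒴 j) (i : ι)
    (γ : N.Strategy 𝒴 i) (d m : Msg) {t : ℕ} (ht : t ≤ N.T) (r : N.MsgHist i t) (h : Fin 2) :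
    ∫ ω in H ⁻¹' {h}, (actSet γ.rule t r m).indicator 1 (fun s => Y i s ω) *
        (N.histEvent Γ i t r).indicator (N.playCost Γ i t d h) (fun j s => Y j s ω) ∂P
      = ∫ z in actSet γ.rule t r m, (N.problem P H Y hobs.measurable_Y Γ i).stopCost d t r h *
        (N.problem P H Y hobs.measurable_Y Γ i).state t (fun s => z s) r h
        ∂(N.problem P H Y hobs.measurable_Y Γ i).refLaw := by
  set D := N.problem P H Y hobs.measurable_Y Γ i with hD
  obtain ⟨A, hA, hAeq⟩ := exists_actSet_eq γ.measurable_rule_left t r m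
  have hz : ∀ z : ℕ → 𝒴 i, (actSet γ.rule t r m).indicator (1 : (ℕ → 𝒴 i) → ℝ) z
      = A.indicator 1 (fun s : Finset.Icc 1 t => z s) := fun z => by
    rw [hAeq]
    rfl
  have hψ : Measurable ((N.histEvent Γ i t r).indicator (N.playCost Γ i t d h)) :=
    (N.measurable_cost _ h).indicator (N.measurableSet_histEvent Γ i t r)
  have key := hobs.setIntegral_mul_eq Γ i h ht (measurable_one.indicator hA) hψ fun y y' hy => by
    by_cases hmem : y ∈ N.histEvent Γ i t r
    · rw [Set.indicator_of_mem hmem,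
        Set.indicator_of_mem ((N.mem_histEvent_congr Γ i ht r hy).mp hmem)]
      exact N.playCost_congr Γ i t d h hy
    · rw [Set.indicator_of_notMem hmem,
        Set.indicator_of_notMem (mt (N.mem_histEvent_congr Γ i ht r hy).mpr hmem)]
  simp only [hz]
  rw [key, ← hD, ← hobs.stopCost_mul_weight, ← hD, ← integral_const_mul,
    ← integral_indicator (measurableSet_actSet γ.measurable_rule_left t r m)]
  refine integral_congr_ae (Filter.Eventually.of_forall fun z => ?_)
  by_cases hmem : z ∈ actSet γ.rule t r m
  · have h1 : (fun s : Finset.Icc 1 t => z s) ∈ A := by rwa [hAeq] at hmem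
    simp only [Set.indicator_of_mem hmem, Set.indicator_of_mem h1, Pi.one_apply, one_mul,
      DetectionProblem.state, Pi.mul_apply, mul_assoc]
  · have h1 : (fun s : Finset.Icc 1 t => z s) ∉ A := by rwa [hAeq] at hmem
    simp only [Set.indicator_of_notMem hmem, Set.indicator_of_notMem h1, zero_mul, mul_zero]

theorem integrable_actSet_mul (hobs : N.ObservationModel P H Y) (Γ : ∀ j, N.Strategy 𝒴 j) (i : ι)
    (γ : N.Strategy 𝒴 i) (d m : Msg) (t : ℕ) (r : N.MsgHist i t) (h : Fin 2) :
    Integrable (fun ω => (actSet γ.rule t r m).indicator 1 (fun s => Y i s ω) *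
        (N.histEvent Γ i t r).indicator (N.playCost Γ i t d h) (fun j s => Y j s ω)) P := by
  have hY := measurable_observations hobs.measurable_Y
  obtain ⟨K, hK⟩ := N.exists_abs_cost_le (Function.update Γ i (N.playAt i t d)) h
  refine Integrable.of_bound (C := K) (Measurable.aestronglyMeasurable (Measurable.mul ?_ ?_))
    (Filter.Eventually.of_forall fun ω => ?_)
  · exact (measurable_one.indicator (measurableSet_actSet γ.measurable_rule_left t r m)).comp
      (measurable_pi_lambda _ fun s => hobs.measurable_Y i s)
  · exact ((N.measurable_cost _ h).indicator (N.measurableSet_histEvent Γ i t r)).comp hY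
  · rw [norm_mul]
    have h1 : ‖(actSet γ.rule t r m).indicator (1 : (ℕ → 𝒴 i) → ℝ) fun s => Y i s ω‖ ≤ 1 :=
      (norm_indicator_le_norm_self _ _).trans (by simp)
    have h2 : ‖(N.histEvent Γ i t r).indicator (N.playCost Γ i t d h) fun j s => Y j s ω‖ ≤ K :=
      (norm_indicator_le_norm_self _ _).trans (hK _)
    exact (mul_le_mul h1 h2 (norm_nonneg _) zero_le_one).trans_eq (one_mul K)

theorem expectedCost_update [Fintype (N.Parents i → Msg)] (hobs : N.ObservationModel P H Y)
    (Γ : ∀ j, N.Strategy 𝒴 j) (γ : N.Strategy 𝒴 i) :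
    N.expectedCost P H Y (Function.update Γ i γ)
      = ∑ t ∈ Finset.Icc 1 N.T,
        (N.problem P H Y hobs.measurable_Y Γ i).stageCost γ.rule t := by
  have hY := measurable_observations hobs.measurable_Y
  set D := N.problem P H Y hobs.measurable_Y Γ i with hD
  have hint := fun d t r h => hobs.integrable_actSet_mul Γ i γ d d t r h
  have hadd : ∀ t r h, Integrable (fun ω =>
      (actSet γ.rule t r Msg.one).indicator 1 (fun s => Y i s ω)
          * (N.histEvent Γ i t r).indicator (N.playCost Γ i t Msg.one h) (fun j s => Y j s ω)
        + (actSet γ.rule t r Msg.zero).indicator 1 (fun s => Y i s ω)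
          * (N.histEvent Γ i t r).indicator (N.playCost Γ i t Msg.zero h) (fun j s => Y j s ω)) P :=
    fun t r h => (hint Msg.one t r h).add (hint Msg.zero t r h)
  have hfib := integral_eq_sum_setIntegral_fiber (P := P) hobs.measurable_H
    (F := fun h ω => N.cost (Function.update Γ i γ) h fun j s => Y j s ω) fun h => by
      obtain ⟨K, hK⟩ := N.exists_abs_cost_le (Function.update Γ i γ) h
      exact Integrable.of_bound (C := K) ((N.measurable_cost _ h).comp hY).aestronglyMeasurable
        (Filter.Eventually.of_forall fun ω => hK _)
  refine hfib.trans ?_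
  have hh : ∀ h, ∫ ω in H ⁻¹' {h}, N.cost (Function.update Γ i γ) h (fun j s => Y j s ω) ∂P
      = ∑ t ∈ Finset.Icc 1 N.T, ∑ r : N.MsgHist i t,
        ((∫ z in actSet γ.rule t r Msg.one,
            D.stopCost Msg.one t r h * D.state t (fun s => z s) r h ∂D.refLaw)
          + ∫ z in actSet γ.rule t r Msg.zero,
            D.stopCost Msg.zero t r h * D.state t (fun s => z s) r h ∂D.refLaw) := by
    intro h
    simp only [N.cost_eq_sum Γ i γ h]
    rw [integral_finsetSum _ fun t _ => (integrable_finsetSum _ fun r _ =>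
      hadd t r h).integrableOn]
    refine Finset.sum_congr rfl fun t ht => ?_
    have htT := (Finset.mem_Icc.mp ht).2
    rw [integral_finsetSum _ fun r _ => (hadd t r h).integrableOn]
    refine Finset.sum_congr rfl fun r _ => ?_
    rw [integral_add (hint Msg.one t r h).integrableOn (hint Msg.zero t r h).integrableOn,
      hobs.setIntegral_actSet_mul Γ i γ _ _ htT, hobs.setIntegral_actSet_mul Γ i γ _ _ htT]
  rw [Finset.sum_congr rfl fun h _ => hh h, Finset.sum_comm]
  refine Finset.sum_congr rfl fun t _ => ?_
  rw [Finset.sum_comm]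
  refine Finset.sum_congr rfl fun r _ => ?_
  have hs : ∀ d h, Integrable (fun z : ℕ → 𝒴 i =>
      D.stopCost d t r h * D.state t (fun s => z s) r h) D.refLaw := fun d h =>
    ((D.integrable_state t r).eval h).const_mul _
  rw [Finset.sum_add_distrib, integral_finsetSum _ fun h _ => (hs Msg.one h).integrableOn,
    integral_finsetSum _ fun h _ => (hs Msg.zero h).integrableOn]

/-! ### The belief -/

/-- Bayes' rule: as long as sensor `i` is silent, its belief is the normalized state of the
decision problem. -/
theorem condExp_silent_eq (hobs : N.ObservationModel P H Y) (Γ : ∀ j, N.Strategy 𝒴 j) (i : ι)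
    {t : ℕ} (ht : t ≤ N.T) :
    (fun ω => normBelief ((N.problem P H Y hobs.measurable_Y Γ i).state t (fun s => Y i s ω)
        (N.silentMsgs Γ i (fun j s => Y j s ω) t)))
      =ᵐ[P] P[(H ⁻¹' {0}).indicator (fun _ => (1 : ℝ)) | MeasurableSpace.comap
        (fun ω => ((fun s : Finset.Icc 1 t => Y i s ω),
          N.silentMsgs Γ i (fun j s => Y j s ω) t)) inferInstance] := by
  classical
  have hY := measurable_observations hobs.measurable_Y
  set D := N.problem P H Y hobs.measurable_Y Γ i with hD
  have hYi : Measurable fun ω (s : Finset.Icc 1 t) => Y i s ω :=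
    measurable_pi_lambda _ fun s => hobs.measurable_Y i s.1
  have hV : Measurable fun ω => N.silentMsgs Γ i (fun j s => Y j s ω) t :=
    (N.measurable_silentMsgs Γ i t).comp hY
  set f : Ω → (Finset.Icc 1 t → 𝒴 i) × N.MsgHist i t := fun ω =>
    ((fun s : Finset.Icc 1 t => Y i s ω), N.silentMsgs Γ i (fun j s => Y j s ω) t) with hf
  have hfm : Measurable f := hYi.prodMk hV
  -- the belief as a function of the information
  let g : (Finset.Icc 1 t → 𝒴 i) × N.MsgHist i t → ℝ := fun p => normBelief (D.state t p.1 p.2)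
  have hg : Measurable g := measurable_from_prod_countable_left fun r =>
    measurable_normBelief.comp (D.measurable_state t r)
  have hg1 : ∀ p, ‖g p‖ ≤ 1 := fun p => by
    have := normBelief_mem_Icc (D.state_nonneg t p.1 p.2)
    rw [Real.norm_eq_abs, abs_of_nonneg this.1]
    exact this.2
  have hH0 : MeasurableSet (H ⁻¹' {0}) := hobs.measurable_H (measurableSet_singleton 0)
  have hgi : Integrable (fun ω => g (f ω)) P := Integrable.of_bound (C := 1)
    (hg.comp hfm).aestronglyMeasurable (Filter.Eventually.of_forall fun ω => hg1 _)
  refine ae_eq_condExp_of_forall_setIntegral_eq hfm.comap_le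
    ((integrable_const (1 : ℝ)).indicator hH0) (fun s _ _ => hgi.integrableOn) ?_
    (hg.comp (comap_measurable f)).aestronglyMeasurable
  rintro _ ⟨B, hB, rfl⟩ -
  -- the integral over the part of the event with a given hypothesis and given messages
  have hBr : ∀ r, MeasurableSet {y | (y, r) ∈ B} := fun r =>
    (measurable_id.prodMk measurable_const : Measurable fun y => (y, r)) hB
  have hpart : ∀ (u : (Finset.Icc 1 t → 𝒴 i) → ℝ) (_ : Measurable u) (r : N.MsgHist i t)
      (h : Fin 2), ∫ ω in H ⁻¹' {h}, {y | (y, r) ∈ B}.indicator u (fun s => Y i s ω)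
          * (N.histEvent Γ i t r).indicator 1 (fun j s => Y j s ω) ∂P
        = ∫ z in {z | ((fun s : Finset.Icc 1 t => z s), r) ∈ B},
          u (fun s => z s) * D.state t (fun s => z s) r h ∂D.refLaw := by
    intro u hu r h
    rw [hobs.setIntegral_mul_eq Γ i h ht (hu.indicator (hBr r))
      (measurable_one.indicator (N.measurableSet_histEvent Γ i t r)) fun y y' hy => by
        by_cases hmem : y ∈ N.histEvent Γ i t r
        · rw [Set.indicator_of_mem hmem,
            Set.indicator_of_mem ((N.mem_histEvent_congr Γ i ht r hy).mp hmem)]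
          rfl
        · rw [Set.indicator_of_notMem hmem,
            Set.indicator_of_notMem (mt (N.mem_histEvent_congr Γ i ht r hy).mpr hmem)]]
    have hw : ∫ ω in H ⁻¹' {h}, (N.histEvent Γ i t r).indicator (1 : (∀ j, ℕ → 𝒴 j) → ℝ)
        (fun j s => Y j s ω) ∂P = D.weight t r h := by
      change ∫ ω in H ⁻¹' {h}, ((fun ω j s => Y j s ω) ⁻¹' N.histEvent Γ i t r).indicator
        (fun _ => (1 : ℝ)) ω ∂P = _
      rw [setIntegral_indicator (hY (N.measurableSet_histEvent Γ i t r)), setIntegral_const,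
        smul_eq_mul, mul_one]
      rfl
    have hms : MeasurableSet {z : ℕ → 𝒴 i | ((fun s : Finset.Icc 1 t => z s), r) ∈ B} :=
      (show Measurable fun (z : ℕ → 𝒴 i) (s : Finset.Icc 1 t) => z s by fun_prop) (hBr r)
    rw [hw, ← integral_const_mul, ← integral_indicator hms]
    refine integral_congr_ae (Filter.Eventually.of_forall fun z => ?_)
    by_cases hmem : ((fun s : Finset.Icc 1 t => z s), r) ∈ B
    · have h1 : (fun s : Finset.Icc 1 t => z s) ∈ {y | (y, r) ∈ B} := hmem
      have h2 : z ∈ {z : ℕ → 𝒴 i | ((fun s : Finset.Icc 1 t => z s), r) ∈ B} := hmem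
      simp only [Set.indicator_of_mem h1, Set.indicator_of_mem h2, DetectionProblem.state,
        Pi.mul_apply, ← hD]
      ring
    · have h1 : (fun s : Finset.Icc 1 t => z s) ∉ {y | (y, r) ∈ B} := hmem
      have h2 : z ∉ {z : ℕ → 𝒴 i | ((fun s : Finset.Icc 1 t => z s), r) ∈ B} := hmem
      simp only [Set.indicator_of_notMem h1, Set.indicator_of_notMem h2, zero_mul, mul_zero]
  have hsplit : ∀ (u : (Finset.Icc 1 t → 𝒴 i) × N.MsgHist i t → ℝ) (_ : Measurable u)
      (_ : ∀ p, ‖u p‖ ≤ 1) (h : Fin 2), ∫ ω in H ⁻¹' {h}, (f ⁻¹' B).indicator (fun ω => u (f ω)) ω ∂P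
        = ∑ r, ∫ z in {z | ((fun s : Finset.Icc 1 t => z s), r) ∈ B},
          u ((fun s => z s), r) * D.state t (fun s => z s) r h ∂D.refLaw := by
    intro u hu hu1 h
    have hur : ∀ r, Measurable fun y => u (y, r) := fun r =>
      hu.comp (measurable_id.prodMk measurable_const)
    rw [← Finset.sum_congr rfl fun r _ => hpart (fun y => u (y, r)) (hur r) r h,
      ← integral_finsetSum]
    · refine integral_congr_ae (Filter.Eventually.of_forall fun ω => ?_)
      simp only
      rw [Finset.sum_eq_single_of_mem (N.silentMsgs Γ i (fun j s => Y j s ω) t)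
        (Finset.mem_univ _)]
      · have hmem : (fun j s => Y j s ω)
            ∈ N.histEvent Γ i t (N.silentMsgs Γ i (fun j s => Y j s ω) t) := rfl
        rw [Set.indicator_of_mem hmem, Pi.one_apply, mul_one]
        rfl
      · intro r _ hr
        have hmem : (fun j s => Y j s ω) ∉ N.histEvent Γ i t r := fun h => hr (Eq.symm h)
        rw [Set.indicator_of_notMem hmem, mul_zero]
    · intro r _
      refine Integrable.integrableOn (Integrable.of_bound (C := 1)
        (Measurable.aestronglyMeasurable (Measurable.mul ?_ ?_))
        (Filter.Eventually.of_forall fun ω => ?_))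
      · exact ((hur r).indicator (hBr r)).comp hYi
      · exact (measurable_one.indicator (N.measurableSet_histEvent Γ i t r)).comp hY
      · rw [norm_mul]
        refine (mul_le_mul ((norm_indicator_le_norm_self _ _).trans (hu1 _))
          ((norm_indicator_le_norm_self _ _).trans ?_) (norm_nonneg _) zero_le_one).trans_eq
          (one_mul (1 : ℝ))
        simp
  have hfB : MeasurableSet (f ⁻¹' B) := hfm hB
  have hL : ∫ ω in f ⁻¹' B, g (f ω) ∂P
      = ∑ h, ∫ ω in H ⁻¹' {h}, (f ⁻¹' B).indicator (fun ω => g (f ω)) ω ∂P := by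
    rw [← integral_indicator hfB]
    exact integral_eq_sum_setIntegral_fiber hobs.measurable_H fun _ => hgi.indicator hfB
  have hR : ∫ ω in f ⁻¹' B, (H ⁻¹' {0}).indicator (fun _ => (1 : ℝ)) ω ∂P
      = ∫ ω in H ⁻¹' {0}, (f ⁻¹' B).indicator (fun _ => (1 : ℝ)) ω ∂P := by
    rw [setIntegral_indicator hH0, setIntegral_indicator hfB, Set.inter_comm]
  refine hL.trans (Eq.trans ?_ hR.symm)
  have hsti : ∀ r h, Integrable (fun z : ℕ → 𝒴 i => g ((fun s => z s), r) *
      D.state t (fun s => z s) r h) D.refLaw := fun r h => by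
    refine ((D.integrable_state t r).eval h).bdd_mul (c := 1)
      (hg.comp (Measurable.prodMk (by fun_prop) measurable_const)).aestronglyMeasurable
      (Filter.Eventually.of_forall fun z => hg1 _)
  rw [Fin.sum_univ_two, hsplit g hg hg1 0, hsplit g hg hg1 1, ← Finset.sum_add_distrib,
    hsplit (fun _ => 1) measurable_const (by simp) 0]
  refine Finset.sum_congr rfl fun r _ => ?_
  rw [← integral_add (hsti r 0).integrableOn (hsti r 1).integrableOn]
  refine integral_congr_ae (Filter.Eventually.of_forall fun z => ?_)
  simp only [g, one_mul]
  rw [← mul_add]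
  exact normBelief_mul_add (D.state_nonneg t _ r)

/-- The belief of an active sensor is the normalized state. On the event that the sensor is active,
its information and the `σ`-algebra generated by its observations and the messages under silence
contain the same events, so the two conditional probabilities agree there. -/
theorem belief_ae_eq (hobs : N.ObservationModel P H Y) (Γ : ∀ j, N.Strategy 𝒴 j) (i : ι)
    (γ : N.Strategy 𝒴 i) {t : ℕ} (ht : t ≤ N.T) :
    ∀ᵐ ω ∂P, N.Active Y (Function.update Γ i γ) i t ω →
      N.belief P H Y (Function.update Γ i γ) i t ω
        = normBelief ((N.problem P H Y hobs.measurable_Y Γ i).state t (fun s => Y i s ω)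
          (N.silentMsgs Γ i (fun j s => Y j s ω) t)) := by
  have hY := measurable_observations hobs.measurable_Y
  have hYi : Measurable fun ω (s : Finset.Icc 1 t) => Y i s ω :=
    measurable_pi_lambda _ fun s => hobs.measurable_Y i s.1
  set f : Ω → (Finset.Icc 1 t → 𝒴 i) × N.MsgHist i t := fun ω =>
    ((fun s : Finset.Icc 1 t => Y i s ω), N.silentMsgs Γ i (fun j s => Y j s ω) t) with hf
  have hfm : Measurable f := hYi.prodMk ((N.measurable_silentMsgs Γ i t).comp hY)
  set f' : Ω → (Finset.Icc 1 t → 𝒴 i) × N.MsgHist i t × (Finset.Ico 1 t → Msg) := fun ω =>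
    ((fun s : Finset.Icc 1 t => Y i s ω), N.received Y (Function.update Γ i γ) i t ω,
      (fun s : Finset.Ico 1 t => N.U Y (Function.update Γ i γ) i s.1 ω)) with hf'
  have hU : ∀ s j, Measurable fun ω => N.U Y (Function.update Γ i γ) j s ω := fun s j =>
    (N.measurable_decision _ s j).comp hY
  have hfm' : Measurable f' := hYi.prodMk (Measurable.prodMk
    (measurable_pi_lambda _ fun s => measurable_pi_lambda _ fun j => hU s.1 j.1)
    (measurable_pi_lambda _ fun s => hU s.1 i))
  set S : Set Ω := {ω | N.Active Y (Function.update Γ i γ) i t ω} with hS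
  have hactive : ∀ ω, ω ∈ S ↔ ∀ s ∈ Finset.Ico 1 t,
      N.decision (Function.update Γ i γ) (fun j s => Y j s ω) s i = Msg.blank := fun ω =>
    ⟨fun h s hs => h ⟨s, hs⟩, fun h s => h s.1 s.2⟩
  -- the two kinds of information coincide while the sensor is active
  have hff' : ∀ ω ∈ S, f' ω = ((f ω).1, (f ω).2, fun _ => Msg.blank) := fun ω hω =>
    Prod.ext rfl (Prod.ext (N.received_eq_silentMsgs Γ i γ ht ((hactive ω).mp hω)) (funext hω))
  let C : Set ((Finset.Icc 1 t → 𝒴 i) × N.MsgHist i t) :=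
    {p | ∀ s : Finset.Ico 1 t, γ.rule s.1 (fun k => p.1 ⟨k.1, Finset.Icc_subset_Icc_right
      (Finset.mem_Ico.mp s.2).2.le k.2⟩) (cutHist (Finset.mem_Ico.mp s.2).2.le p.2) = Msg.blank}
  have hC : MeasurableSet C := by
    refine MeasurableSet.congr (s := ⋂ s : Finset.Ico 1 t,
      (fun p : (Finset.Icc 1 t → 𝒴 i) × N.MsgHist i t => γ.rule s.1
        (fun k => p.1 ⟨k.1, Finset.Icc_subset_Icc_right (Finset.mem_Ico.mp s.2).2.le k.2⟩)
        (cutHist (Finset.mem_Ico.mp s.2).2.le p.2)) ⁻¹' {Msg.blank})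
      (MeasurableSet.iInter fun s => ?_) (Set.ext fun p => by simp only [Set.mem_iInter]; rfl)
    refine Measurable.comp (γ.measurable_rule s.1) (Measurable.prodMk ?_ ?_)
      (measurableSet_singleton Msg.blank)
    · fun_prop
    · exact measurable_pi_lambda _ fun k => (measurable_pi_apply _).comp measurable_snd
  have hSC : S = f ⁻¹' C := Set.ext fun ω => (hactive ω).trans
    (N.mem_contSet_iff Γ i γ (y := fun j s => Y j s ω) ht).symm
  have hB0 : MeasurableSet {p : (Finset.Icc 1 t → 𝒴 i) × N.MsgHist i t × (Finset.Ico 1 t → Msg) |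
      p.2.2 = fun _ => Msg.blank} :=
    (measurable_snd.comp measurable_snd) (measurableSet_singleton _)
  have hSB0 : S = f' ⁻¹' {p | p.2.2 = fun _ => Msg.blank} :=
    Set.ext fun ω => ⟨fun h => funext h, fun h s => congrFun h s⟩
  have hmS : MeasurableSet[N.info Y (Function.update Γ i γ) i t] S := ⟨_, hB0, hSB0.symm⟩
  have hrestr := condExp_ae_eq_restrict_of_measurableSpace_eq_on (μ := P)
    (f := (H ⁻¹' {0}).indicator (fun _ => (1 : ℝ))) (m := N.info Y (Function.update Γ i γ) i t)
    (m₂ := MeasurableSpace.comap f inferInstance) hfm'.comap_le hfm.comap_le hmS fun A => by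
      constructor
      · rintro ⟨B, hB, hBA⟩
        refine ⟨C ∩ (fun p => (p.1, p.2, fun _ => Msg.blank)) ⁻¹' B, hC.inter (?_), ?_⟩
        · exact (measurable_fst.prodMk (measurable_snd.prodMk measurable_const)) hB
        · rw [Set.preimage_inter, ← hSC, ← hBA]
          ext ω
          constructor
          · rintro ⟨h1, h2⟩
            change f' ω ∈ B
            rw [hff' ω h1]
            exact h2
          · intro h
            have h1 : ω ∈ S := by
              rw [hBA] at h
              exact h.1
            refine ⟨h1, ?_⟩
            change f' ω ∈ B at h
            rw [hff' ω h1] at h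
            exact h
      · rintro ⟨B, hB, hBA⟩
        refine ⟨{p | p.2.2 = fun _ => Msg.blank} ∩ (fun p => (p.1, p.2.1)) ⁻¹' B,
          hB0.inter ?_, ?_⟩
        · exact (measurable_fst.prodMk (measurable_fst.comp measurable_snd)) hB
        · rw [Set.preimage_inter, ← hSB0, ← hBA]
          ext ω
          constructor
          · rintro ⟨h1, h2⟩
            change ((f' ω).1, (f' ω).2.1) ∈ B at h2
            rw [hff' ω h1] at h2
            exact h2
          · intro h
            have h1 : ω ∈ S := by
              rw [hBA] at h
              exact h.1
            refine ⟨h1, ?_⟩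
            change ((f' ω).1, (f' ω).2.1) ∈ B
            rw [hff' ω h1]
            exact h
  have hSm : MeasurableSet S := hfm'.comap_le _ hmS
  filter_upwards [(ae_restrict_iff' hSm).mp hrestr, hobs.condExp_silent_eq Γ i ht] with ω h1 h2 hω
  rw [h2]
  exact h1 hω

end ObservationModel

/-! ### The optimal strategy -/

/-- The strategy that applies four-threshold rules to the normalized state of the decision
problem. At the horizon the two intervals have to cover `[0, 1]`. -/
noncomputable def thresholdStrategy {i : ι} (D : DetectionProblem (N.Parents i → Msg) (𝒴 i))
    (α β δ θ : ∀ t : ℕ, N.MsgHist i t → ℝ)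
    (hT : ∀ u, Set.Icc (α N.T u) (β N.T u) ∪ Set.Icc (δ N.T u) (θ N.T u) = Set.Icc (0 : ℝ) 1) :
    N.Strategy 𝒴 i where
  rule t y u := fourThreshold (α t u) (β t u) (δ t u) (θ t u) (normBelief (D.state t y u))
  measurable_rule t := by
    refine measurable_from_prod_countable_left fun u => ?_
    have hm := measurable_normBelief.comp (D.measurable_state t u)
    exact (measurable_fourThreshold (α t u) (β t u) (δ t u) (θ t u)).comp hm
  stops y u := by
    have hmem := normBelief_mem_Icc (D.state_nonneg N.T y u)
    rw [← hT u] at hmem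
    unfold fourThreshold
    split_ifs with h1 h2
    · simp
    · simp
    · exact absurd hmem (not_or.mpr ⟨h1, h2⟩)

end SensorNetwork

theorem theorem2 {ι : Type*} [Fintype ι] [DecidableEq ι] {𝒴 : ι → Type*}
    [∀ i, MeasurableSpace (𝒴 i)] {Ω : Type*} [MeasurableSpace Ω] (P : Measure Ω)
    [IsProbabilityMeasure P] (N : SensorNetwork ι) (H : Ω → Fin 2) (Y : ∀ i, ℕ → Ω → 𝒴 i)
    (hobs : N.ObservationModel P H Y) (i : ι) (Γ : ∀ j, N.Strategy 𝒴 j) :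
    ∃ γ : N.Strategy 𝒴 i, N.IsOptimalFor P H Y Γ i γ ∧
      ∃ α β δ θ : ∀ t : ℕ, N.MsgHist i t → ℝ,
        (∀ t ∈ Finset.Icc 1 N.T,
          (∀ u : N.MsgHist i t,
            α t u ∈ Set.Icc (0 : ℝ) 1 ∧ β t u ∈ Set.Icc (0 : ℝ) 1 ∧
            δ t u ∈ Set.Icc (0 : ℝ) 1 ∧ θ t u ∈ Set.Icc (0 : ℝ) 1 ∧
            (Set.Icc (α t u) (β t u) ∩ Set.Icc (δ t u) (θ t u)).Subsingleton) ∧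
          ∀ᵐ ω ∂P, N.Active Y (Function.update Γ i γ) i t ω →
            N.U Y (Function.update Γ i γ) i t ω =
              fourThreshold
                (α t (N.received Y (Function.update Γ i γ) i t ω))
                (β t (N.received Y (Function.update Γ i γ) i t ω))
                (δ t (N.received Y (Function.update Γ i γ) i t ω))
                (θ t (N.received Y (Function.update Γ i γ) i t ω))
                (N.belief P H Y (Function.update Γ i γ) i t ω)) ∧
        ∀ u : N.MsgHist i N.T,
          Set.Icc (α N.T u) (β N.T u) ∪ Set.Icc (δ N.T u) (θ N.T u) = Set.Icc (0 : ℝ) 1 := by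
  have : Fintype (N.Parents i → Msg) := Fintype.ofFinite _
  set D := N.problem P H Y hobs.measurable_Y Γ i with hD
  choose α β δ θ hmem hopt hlast using fun (t : ℕ) (r : N.MsgHist i t) =>
    exists_fourThreshold_optimal (D.stopCost Msg.one t r) (D.stopCost Msg.zero t r)
      (D.isCostToGo_contCost (N.T - t) t r)
  have hT : ∀ u : N.MsgHist i N.T,
      Set.Icc (α N.T u) (β N.T u) ∪ Set.Icc (δ N.T u) (θ N.T u) = Set.Icc (0 : ℝ) 1 := fun u =>
    hlast N.T u fun b => by
      rw [Nat.sub_self]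
      rfl
  let γ : N.Strategy 𝒴 i := SensorNetwork.thresholdStrategy D α β δ θ hT
  refine ⟨γ, fun γ' => ?_, α, β, δ, θ, fun t ht => ⟨hmem t, ?_⟩, hT⟩
  · rw [hobs.expectedCost_update, hobs.expectedCost_update, ← hD]
    exact D.sum_stageCost_le γ.measurable_rule_left N.one_le_T γ.stops
      (fun t y r => actionCost_eq_minCost_of_normBelief (D.isCostToGo_contCost _ t r)
        (D.state_nonneg t y r) (hopt t r _ (normBelief_mem_Icc (D.state_nonneg t y r))))
      γ'.measurable_rule_left γ'.stops
  · have htT := (Finset.mem_Icc.mp ht).2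
    filter_upwards [hobs.belief_ae_eq Γ i γ htT] with ω hω hact
    have hact' : ∀ s ∈ Finset.Ico 1 t, N.decision (Function.update Γ i γ) (fun j s => Y j s ω) s i
        = Msg.blank := fun s hs => hact ⟨s, hs⟩
    have hrec : N.received Y (Function.update Γ i γ) i t ω
        = N.silentMsgs Γ i (fun j s => Y j s ω) t :=
      N.received_eq_silentMsgs Γ i γ htT hact'
    rw [hω hact, ← hrec]
    refine (N.decision_of_active hact').trans ?_
    rw [Function.update_self]
    rfl
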